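/- For a congruence subgroup $\Gamma\le\mathrm{SL}_2(\mathbb Z)$, call two binary quadratic forms $Q,Q'$ over $\mathbb Z$ $\Gamma$-equivalent if $Q'(x,y)=Q(\alpha x+\beta y,\gamma x+\delta y)$ for some $\left(\begin{smallmatrix}\alpha&\beta\\ \gamma&\delta\end{smallmatrix}\right)\in\Gamma$. Let $D<0$ be an integer with $D\equiv 0,1\pmod 4$ and let $N\ge 1$ be an integer. Let $\mathcal C(D,\Gamma_0(N))$ be the set of $\Gamma_0(N)$-equivalence classes of primitive positive-definite forms $ax^2+bxy+cy^2$ of discriminant $b^2-4ac=D$ with $\gcd(a,N)=1$. For two such forms $Q=ax^2+bxy+cy^2$ and $Q'=a'x^2+b'xy+c'y^2$ with $\gcd\bigl(a,a',\tfrac{b+b'}2\bigr)=1$, there is an integer $B$, unique modulo $2aa'$, with $B\equiv b\pmod{2a}$, $B\equiv b'\pmod{2a'}$, $B^2\equiv D\pmod{4aa'}$; the Dirichlet composition of $Q$ and $Q'$ is the form $Q''=aa'x^2+Bxy+\frac{B^2-D}{4aa'}y^2$. Then any two classes in $\mathcal C(D,\Gamma_0(N))$ have representatives $Q,Q'$ with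 $\gcd(a,a')=1$; for every pair of forms $Q,Q'$ as above and every admissible $B$, the form $Q''$ is again primitive, positive definite, of discriminant $D$, with leading coefficient prime to $N$, and its class depends only on the classes of $Q$ and $Q'$; and the operation $[Q]\cdot[Q']=[Q'']$ makes $\mathcal C(D,\Gamma_0(N))$ an abelian group. Moreover, let $K\subset\mathbb C$ be an imaginary quadratic field with discriminant $d_K$ and ring of integers $\mathcal O_K$, and let $\mathcal O=\mathbb Z+f\mathcal O_K$ be its order of discriminant $f^2d_K=D$. A fractional $\mathcal O$-ideal $\mathfrak a$ is proper if $\{\alpha\in K:\alpha\mathfrak a\subset\mathfrak a\}=\mathcal O$; the proper fractional $\mathcal O$-ideals are exactly the invertible ones, so they form a group $\mathcal I(\mathcal O)$. Let $\mathcal I(\mathcal O,N)\le\mathcal I(\mathcal O)$ be the subgroup generated by the proper ideals $\mathfrak a\subset\mathcal O$ with $\mathfrak a+N\mathcal O=\mathcal O$, let $\mathcal P_0(\mathcal O,N)$ be the subgroup generated by the principal ideals $\alpha\mathcal O$ with $0\neq\alpha\in\mathcal O$ and $\alpha\equiv a\pmod{N\mathcal O}$ for some $a\in\mathbb Z$ with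 $\gcd(a,N)=1$, and put $\mathcal C_0(\mathcal O,N)=\mathcal I(\mathcal O,N)/\mathcal P_0(\mathcal O,N)$. For a form $Q$ let $\tau_Q$ be the root of $Q(x,1)=0$ in the upper half plane. Then $\Phi:[Q]\mapsto[\mathbb Z+\mathbb Z\tau_Q]$ is a well-defined group isomorphism $\mathcal C(D,\Gamma_0(N))\to\mathcal C_0(\mathcal O,N)$. -/

import Mathlib

open scoped nonZeroDivisors

/-- The binary quadratic form `a x² + b x y + c y²` with integer coefficients. -/
@[ext]
structure BinForm where
  a : ℤ
  b : ℤ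
  c : ℤ

namespace BinForm

/-- The value `Q(x, y)`. -/
def eval (Q : BinForm) (x y : ℤ) : ℤ := Q.a * x ^ 2 + Q.b * x * y + Q.c * y ^ 2

def disc (Q : BinForm) : ℤ := Q.b ^ 2 - 4 * Q.a * Q.c

def IsPrimitive (Q : BinForm) : Prop := Int.gcd (Int.gcd Q.a Q.b) Q.c = 1

def IsPosDef (Q : BinForm) : Prop := ∀ x y : ℤ, (x, y) ≠ (0, 0) → 0 < Q.eval x y

/-- `Q'` is `Γ`-equivalent to `Q`: `Q'(x, y) = Q(αx + βy, γx + δy)` for some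
`(α β; γ δ) ∈ Γ`. -/
def Equivalent (Γ : Subgroup (Matrix.SpecialLinearGroup (Fin 2) ℤ)) (Q Q' : BinForm) : Prop :=
  ∃ g ∈ Γ, ∀ x y : ℤ, Q'.eval x y = Q.eval (g 0 0 * x + g 0 1 * y) (g 1 0 * x + g 1 1 * y)

/-- The root of `Q(x, 1) = 0` in the upper half plane (for `Q` positive definite). -/
noncomputable def tau (Q : BinForm) : ℂ :=
  (-(Q.b : ℂ) + (Real.sqrt (-(Q.disc : ℝ)) : ℂ) * Complex.I) / (2 * (Q.a : ℂ))

theorem IsPosDef.a_pos {Q : BinForm} (h : Q.IsPosDef) : 0 < Q.a := by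
  have := h 1 0 (by simp)
  simpa [eval] using this

theorem IsPosDef.disc_neg {Q : BinForm} (h : Q.IsPosDef) : Q.disc < 0 := by
  have ha := h.a_pos
  have h1 := h (-Q.b) (2 * Q.a) (by simp; omega)
  simp only [eval] at h1
  simp only [disc]
  nlinarith

/-- `tau Q` is the unique solution of `Q(x, 1) = 0` in the upper half plane. -/
theorem IsPosDef.eq_tau_iff {Q : BinForm} (h : Q.IsPosDef) (z : ℂ) :
    z = Q.tau ↔ 0 < z.im ∧ (Q.a : ℂ) * z ^ 2 + (Q.b : ℂ) * z + (Q.c : ℂ) = 0 := by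
  have ha : (0 : ℝ) < Q.a := by exact_mod_cast h.a_pos
  have hd : (Q.disc : ℝ) < 0 := by exact_mod_cast h.disc_neg
  set s := Real.sqrt (-(Q.disc : ℝ)) with hs
  have hspos : 0 < s := Real.sqrt_pos.mpr (by linarith)
  have hsq : s ^ 2 = -(Q.disc : ℝ) := Real.sq_sqrt (by linarith)
  have hsqC : (s : ℂ) ^ 2 = -((Q.b : ℂ) ^ 2 - 4 * Q.a * Q.c) := by
    have : ((s ^ 2 : ℝ) : ℂ) = ((-(Q.disc : ℝ) : ℝ) : ℂ) := by rw [hsq]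
    simpa [disc] using this
  have haC : (Q.a : ℂ) ≠ 0 := by exact_mod_cast h.a_pos.ne'
  have key : z = Q.tau ↔ 2 * (Q.a : ℂ) * z + Q.b = s * Complex.I := by
    rw [tau, eq_div_iff (by simpa using haC)]
    constructor <;> intro h' <;> linear_combination h'
  rw [key]
  constructor
  · intro hz
    constructor
    · have := congrArg Complex.im hz
      simp at this
      nlinarith
    · have h4 : 4 * (Q.a : ℂ) * ((Q.a : ℂ) * z ^ 2 + (Q.b : ℂ) * z + (Q.c : ℂ)) = 0 := by
        linear_combination (2 * (Q.a : ℂ) * z + Q.b + s * Complex.I) * hz - hsqC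
          + (s : ℂ) ^ 2 * Complex.I_sq
      simpa [haC] using h4
  · rintro ⟨him, hz⟩
    have hfac : (2 * (Q.a : ℂ) * z + Q.b - s * Complex.I) *
        (2 * (Q.a : ℂ) * z + Q.b + s * Complex.I) = 0 := by
      linear_combination 4 * (Q.a : ℂ) * hz + hsqC - (s : ℂ) ^ 2 * Complex.I_sq
    rcases mul_eq_zero.mp hfac with h1 | h1
    · linear_combination h1
    · exfalso
      have := congrArg Complex.im h1
      simp at this
      nlinarith [mul_pos ha him]

theorem Equivalent.refl (Γ : Subgroup (Matrix.SpecialLinearGroup (Fin 2) ℤ)) (Q : BinForm) :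
    Equivalent Γ Q Q :=
  ⟨1, Γ.one_mem, fun x y => by simp⟩

theorem Equivalent.symm {Γ : Subgroup (Matrix.SpecialLinearGroup (Fin 2) ℤ)} {Q Q' : BinForm}
    (h : Equivalent Γ Q Q') : Equivalent Γ Q' Q := by
  obtain ⟨g, hg, h⟩ := h
  refine ⟨g⁻¹, Γ.inv_mem hg, fun x y => ?_⟩
  have hdet : g 0 0 * g 1 1 - g 0 1 * g 1 0 = 1 := by
    rw [← Matrix.det_fin_two]; exact g.det_coe
  rw [h]
  simp only [Matrix.SpecialLinearGroup.SL2_inv_expl, Matrix.cons_val',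
    Matrix.cons_val_zero, Matrix.cons_val_one, Matrix.cons_val_fin_one]
  congr 1
  · linear_combination -x * hdet
  · linear_combination -y * hdet

theorem Equivalent.trans {Γ : Subgroup (Matrix.SpecialLinearGroup (Fin 2) ℤ)}
    {Q Q' Q'' : BinForm} (h : Equivalent Γ Q Q') (h' : Equivalent Γ Q' Q'') :
    Equivalent Γ Q Q'' := by
  obtain ⟨g, hg, h⟩ := h
  obtain ⟨g', hg', h'⟩ := h'
  refine ⟨g * g', Γ.mul_mem hg hg', fun x y => ?_⟩
  rw [h', h]
  simp only [Matrix.SpecialLinearGroup.coe_mul, Matrix.mul_apply, Fin.sum_univ_two]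
  congr 1 <;> ring

/-- `gcd(a, a', (b + b')/2) = 1`. For forms of the same discriminant `b + b'` is even. -/
def Composable (Q Q' : BinForm) : Prop :=
  Int.gcd (Int.gcd Q.a Q'.a) ((Q.b + Q'.b) / 2) = 1

/-- The congruences on the middle coefficient `B` of the Dirichlet composition. -/
def IsCompCoeff (D : ℤ) (Q Q' : BinForm) (B : ℤ) : Prop :=
  B ≡ Q.b [ZMOD 2 * Q.a] ∧ B ≡ Q'.b [ZMOD 2 * Q'.a] ∧ B ^ 2 ≡ D [ZMOD 4 * (Q.a * Q'.a)]

/-- The Dirichlet composition `aa' x² + B x y + (B² - D)/(4aa') y²`; the division is exact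
when `IsCompCoeff D Q Q' B`. -/
def dirichletComp (D : ℤ) (Q Q' : BinForm) (B : ℤ) : BinForm :=
  ⟨Q.a * Q'.a, B, (B ^ 2 - D) / (4 * (Q.a * Q'.a))⟩

end BinForm

/-- Primitive positive definite forms of discriminant `D` whose `x²`-coefficient is prime
to `N`. -/
def QF (D : ℤ) (N : ℕ) : Type :=
  {Q : BinForm // Q.IsPrimitive ∧ Q.IsPosDef ∧ Q.disc = D ∧ Int.gcd Q.a N = 1}

/-- `Γ₀(N)`-equivalence. -/
instance QF.setoid (D : ℤ) (N : ℕ) : Setoid (QF D N) where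
  r Q Q' := BinForm.Equivalent (CongruenceSubgroup.Gamma0 N) Q.1 Q'.1
  iseqv := ⟨fun Q => BinForm.Equivalent.refl _ Q.1, fun h => h.symm, fun h h' => h.trans h'⟩

/-- `C(D, Γ₀(N))`. -/
def FormClass (D : ℤ) (N : ℕ) : Type := Quotient (QF.setoid D N)

/-- The class `[Q]` in `C(D, Γ₀(N))`. -/
def FormClass.mk {D : ℤ} {N : ℕ} (Q : QF D N) : FormClass D N := Quotient.mk _ Q

/-- The order `ℤ + f 𝓞_K` of conductor `f`. -/
def quadOrder (K : Type*) [Field K] (f : ℕ) : Subring K where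
  carrier := {x | ∃ (m : ℤ) (y : NumberField.RingOfIntegers K), x = m + f * (y : K)}
  zero_mem' := ⟨0, 0, by simp⟩
  one_mem' := ⟨1, 0, by simp⟩
  add_mem' := by
    rintro _ _ ⟨m, y, rfl⟩ ⟨m', y', rfl⟩
    exact ⟨m + m', y + y', by push_cast; ring⟩
  neg_mem' := by
    rintro _ ⟨m, y, rfl⟩
    exact ⟨-m, -y, by push_cast; ring⟩
  mul_mem' := by
    rintro _ _ ⟨m, y, rfl⟩ ⟨m', y', rfl⟩
    exact ⟨m * m', m • y' + m' • y + f • (y * y'), by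
      simp only [map_add, map_mul, map_intCast, map_natCast, zsmul_eq_mul, nsmul_eq_mul]
      push_cast; ring⟩

section Ideals

variable {K : Type*} [Field K] (O : Subring K)

/-- A fractional `O`-ideal `I` is proper if `O = {α ∈ K | α I ⊆ I}`. -/
def IsProperIdeal {O : Subring K} (I : FractionalIdeal O⁰ K) : Prop :=
  {α : K | ∀ x ∈ I, α * x ∈ I} = (O : Set K)

/-- `I(O, N)`: the subgroup generated by the proper ideals `I ⊆ O` with `I + N O = O`, inside
the group of invertible fractional ideals. (Invertible ideals are proper by
`IsProperIdeal.of_isUnit`; in a quadratic order proper ideals are invertible.) -/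
def idealGroup (N : ℕ) : Subgroup (FractionalIdeal O⁰ K)ˣ :=
  Subgroup.closure {u | ∃ I : Ideal O, (u : FractionalIdeal O⁰ K) = (I : FractionalIdeal O⁰ K) ∧
    IsProperIdeal (u : FractionalIdeal O⁰ K) ∧ I ⊔ Ideal.span {(N : O)} = ⊤}

/-- `P₀(O, N)`: the subgroup generated by the (nonzero) principal ideals `α O` with `α ∈ O`,
`α ≡ a (mod N O)` for some integer `a` prime to `N`. -/
def principalGroup₀ (N : ℕ) : Subgroup (FractionalIdeal O⁰ K)ˣ :=
  Subgroup.closure {u | ∃ (α : O) (a : ℤ), Int.gcd a N = 1 ∧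
    α - (a : O) ∈ Ideal.span {(N : O)} ∧
    (u : FractionalIdeal O⁰ K) = ((Ideal.span {α} : Ideal O) : FractionalIdeal O⁰ K)}

theorem IsProperIdeal.of_isUnit {O : Subring K} {I : FractionalIdeal O⁰ K} (hI : IsUnit I) :
    IsProperIdeal I := by
  obtain ⟨u, rfl⟩ := hI
  ext α
  simp only [Set.mem_ofPred_eq, SetLike.mem_coe]
  constructor
  · intro h
    have hone : (1 : K) ∈ ((u : FractionalIdeal O⁰ K) * (↑u⁻¹ : FractionalIdeal O⁰ K)) := by
      rw [Units.mul_inv]; exact FractionalIdeal.one_mem_one _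
    have : ∀ x ∈ ((u : FractionalIdeal O⁰ K) * (↑u⁻¹ : FractionalIdeal O⁰ K)),
        α * x ∈ ((u : FractionalIdeal O⁰ K) * (↑u⁻¹ : FractionalIdeal O⁰ K)) := by
      intro x hx
      refine FractionalIdeal.mul_induction_on hx (fun i hi j hj => ?_) (fun x y hx hy => ?_)
      · rw [← mul_assoc]
        exact FractionalIdeal.mul_mem_mul (h i hi) hj
      · rw [mul_add]
        exact Submodule.add_mem _ hx hy
    have h1 := this 1 hone
    rw [Units.mul_inv, mul_one] at h1
    obtain ⟨y, hy⟩ := (FractionalIdeal.mem_one_iff _).mp h1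
    rw [← hy]
    exact y.2
  · intro hα x hx
    exact Submodule.smul_mem (u : FractionalIdeal O⁰ K).coeToSubmodule (⟨α, hα⟩ : O) hx

theorem principalGroup₀_le_idealGroup (N : ℕ) : principalGroup₀ O N ≤ idealGroup O N := by
  refine Subgroup.closure_mono ?_
  rintro u ⟨α, a, ha, hα, hu⟩
  refine ⟨Ideal.span {α}, hu, IsProperIdeal.of_isUnit u.isUnit, ?_⟩
  rw [Ideal.eq_top_iff_one]
  have hN : (N : O) ∈ Ideal.span {α} ⊔ Ideal.span {(N : O)} :=
    Ideal.mem_sup_right (Ideal.mem_span_singleton_self _)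
  have hα' : α ∈ Ideal.span {α} ⊔ Ideal.span {(N : O)} :=
    Ideal.mem_sup_left (Ideal.mem_span_singleton_self _)
  have haO : (a : O) ∈ Ideal.span {α} ⊔ Ideal.span {(N : O)} := by
    have := Ideal.sub_mem _ hα' (Ideal.mem_sup_right hα)
    simpa using this
  obtain ⟨r, s, hrs⟩ := Int.isCoprime_iff_gcd_eq_one.mpr ha
  have h1 : (1 : O) = (r : O) * (a : O) + (s : O) * (N : O) := by
    have := congrArg (Int.cast : ℤ → O) hrs
    push_cast at this
    exact this.symm
  rw [h1]
  exact Ideal.add_mem _ (Ideal.mul_mem_left _ _ haO) (Ideal.mul_mem_left _ _ hN)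

/-- `C₀(O, N) = I(O, N) / P₀(O, N)`. -/
abbrev RingClass₀ (N : ℕ) : Type _ :=
  idealGroup O N ⧸ (principalGroup₀ O N).subgroupOf (idealGroup O N)

end Ideals

/-! To a form attach the lattice ℤ + ℤτ, where τ = (−b + δ)/2a and δ² = D. Since 1 and aτ span the
order O of discriminant D, this lattice is a fractional O-ideal (`mem_rootIdeal`). For a primitive
form it is invertible, its inverse being a times the lattice of the conjugate form
(`rootIdeal_mul_conj`). Dirichlet composition is multiplication of these lattices
(`rootIdeal_mul_rootIdeal`).

A substitution in SL₂(ℤ) scales the lattice by γτ' + d. If N ∣ γ, then a'(γτ' + d) is congruent mod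
N to an integer prime to N, so Γ₀(N)-equivalent forms give the same class modulo P₀. Conversely, two
lattices proportional by such factors are related by an integral matrix of determinant ±1.
Positivity of the forms makes the sign +, and the congruences force N ∣ γ (`toRingClass_injective`).
Every integral generator of I(O, N) is sa(ℤ + ℤτ) with sa prime to N (`exists_coeIdeal_eq`), and the
image is closed under products and inverses (`toRingClass_surjective`).

The group law on form classes is transported along this bijection, so neither associativity nor
independence of representatives needs any computation with forms. The law must exist before a field
K is given, so it comes from an auxiliary order in ℚ(√D). `IsQuadOrder` collects what that order
shares with ℤ + f𝓞_K. For each K the bijection is then multiplicative, because both products are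
computed by Dirichlet composition. -/

namespace BinForm

/-! ### Dirichlet composition: the middle coefficient and the invariants of the composed form. -/

theorem isPosDef_of_a_pos {Q : BinForm} (ha : 0 < Q.a) (hd : Q.disc < 0) : Q.IsPosDef := by
  intro x y hxy
  have key : 4 * Q.a * Q.eval x y = (2 * Q.a * x + Q.b * y) ^ 2 + (-Q.disc) * y ^ 2 := by
    simp only [eval, disc]; ring
  have hpos : 0 < 4 * Q.a * Q.eval x y := by
    rw [key]
    rcases eq_or_ne y 0 with rfl | hy
    · have hx : x ≠ 0 := by rintro rfl; exact hxy rfl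
      have : 0 < (2 * Q.a * x) ^ 2 := by positivity
      simpa using this
    · have : 0 < (-Q.disc) * y ^ 2 := mul_pos (by omega) (by positivity)
      positivity
  exact pos_of_mul_pos_right hpos (by positivity)

theorem isPrimitive_iff {Q : BinForm} :
    Q.IsPrimitive ↔ ∀ d : ℤ, d ∣ Q.a → d ∣ Q.b → d ∣ Q.c → IsUnit d := by
  unfold IsPrimitive
  constructor
  · intro h d h1 h2 h3
    have h4 := Int.dvd_coe_gcd (Int.dvd_coe_gcd h1 h2) h3
    rw [h] at h4
    exact isUnit_of_dvd_one (by simpa using h4)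
  · intro h
    have h1 := h (Int.gcd (Int.gcd Q.a Q.b) Q.c)
      ((Int.gcd_dvd_left _ _).trans (Int.gcd_dvd_left _ _))
      ((Int.gcd_dvd_left _ _).trans (Int.gcd_dvd_right _ _)) (Int.gcd_dvd_right _ _)
    simpa using Int.isUnit_iff_natAbs_eq.mp h1

theorem isPrimitive_of_prime {Q : BinForm} (ha : Q.a ≠ 0)
    (h : ∀ p : ℤ, Prime p → p ∣ Q.a → p ∣ Q.b → p ∣ Q.c → False) : Q.IsPrimitive := by
  rw [isPrimitive_iff]
  intro d h1 h2 h3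
  by_contra hd
  have hd0 : d ≠ 0 := by rintro rfl; exact ha (zero_dvd_iff.mp h1)
  obtain ⟨p, hp, hpd⟩ := WfDvdMonoid.exists_irreducible_factor hd hd0
  exact h p hp.prime (hpd.trans h1) (hpd.trans h2) (hpd.trans h3)

theorem IsPrimitive.not_prime_dvd {Q : BinForm} (h : Q.IsPrimitive) {p : ℤ} (hp : Prime p)
    (h1 : p ∣ Q.a) (h2 : p ∣ Q.b) (h3 : p ∣ Q.c) : False :=
  hp.not_isUnit (isPrimitive_iff.mp h p h1 h2 h3)

/-- A Bézout relation between the coefficients of a primitive form. -/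
theorem IsPrimitive.exists_bezout {Q : BinForm} (h : Q.IsPrimitive) :
    ∃ x y z : ℤ, x * Q.a + y * Q.b + z * Q.c = 1 := by
  obtain ⟨u, v, huv⟩ := Int.isCoprime_iff_gcd_eq_one.mpr h
  have := Int.gcd_eq_gcd_ab Q.a Q.b
  exact ⟨u * Q.a.gcdA Q.b, u * Q.a.gcdB Q.b, v, by rw [← huv, this]; ring⟩

/-- Both b² and b'² are congruent to D mod 4, so b and b' have the same parity. Hence the integer
division in `Composable` is exact. -/
theorem even_b_add {Q Q' : BinForm} (h : Q.disc = Q'.disc) :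
    Q.b + Q'.b = 2 * ((Q.b + Q'.b) / 2) := by
  have h1 : Even (Q.b ^ 2 - Q'.b ^ 2) :=
    ⟨2 * (Q.a * Q.c - Q'.a * Q'.c), by simp only [disc] at h; linear_combination h⟩
  have h2 : Even (Q.b + Q'.b) := by
    rw [Int.even_add, ← Int.even_sub]
    rw [Int.even_sub, Int.even_pow' two_ne_zero, Int.even_pow' two_ne_zero, ← Int.even_sub] at h1
    exact h1
  obtain ⟨k, hk⟩ := h2
  omega

theorem Composable.exists_bezout {Q Q' : BinForm} (h : Q.Composable Q') :
    ∃ x y z : ℤ, x * Q.a + y * Q'.a + z * ((Q.b + Q'.b) / 2) = 1 := by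
  obtain ⟨u, v, huv⟩ := Int.isCoprime_iff_gcd_eq_one.mpr h
  have := Int.gcd_eq_gcd_ab Q.a Q'.a
  exact ⟨u * Q.a.gcdA Q'.a, u * Q.a.gcdB Q'.a, v, by rw [← huv, this]; ring⟩

theorem composable_of_gcd_eq_one {Q Q' : BinForm} (h : Int.gcd Q.a Q'.a = 1) :
    Q.Composable Q' := by
  simp [Composable, h]

/-- With s = (b + b')/2 and e = (bb' + D)/2, an admissible B satisfies aB ≡ ab', a'B ≡ a'b and sB ≡
e mod 2aa'. Combining these with the Bézout coefficients of a, a', s dictates B = xab' + ya'b + ze.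
The quadratic congruence comes from B² − D = (B − b)(B − b') + 2(sB − e). -/
theorem exists_isCompCoeff {D : ℤ} {Q Q' : BinForm} (hQ : Q.disc = D) (hQ' : Q'.disc = D)
    (h : Q.Composable Q') : ∃ B, Q.IsCompCoeff D Q' B := by
  obtain ⟨x, y, z, hxyz⟩ := h.exists_bezout
  have hs := even_b_add (hQ.trans hQ'.symm)
  set s := (Q.b + Q'.b) / 2
  simp only [disc] at hQ hQ'
  have hb' : Q'.b = 2 * s - Q.b := by omega
  have hB : ∃ e, Q.b * Q'.b + D = 2 * e := by
    refine ⟨Q.b * s - 2 * Q.a * Q.c, ?_⟩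
    rw [hb', ← hQ]; ring
  obtain ⟨e, he⟩ := hB
  have h1 : x * Q.a * Q'.b + y * Q'.a * Q.b + z * e - Q.b =
      2 * Q.a * (x * (s - Q.b) - z * Q.c) := by
    rw [← mul_right_inj' (two_ne_zero (α := ℤ))]
    linear_combination 2 * Q.b * hxyz - z * he - z * hQ + 2 * x * Q.a * hb' + z * Q.b * hb'
  have h2 : x * Q.a * Q'.b + y * Q'.a * Q.b + z * e - Q'.b =
      2 * Q'.a * (y * (s - Q'.b) - z * Q'.c) := by
    rw [← mul_right_inj' (two_ne_zero (α := ℤ))]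
    linear_combination 2 * Q'.b * hxyz - z * he - z * hQ' + 2 * y * Q'.a * hb' + z * Q'.b * hb'
  have h3 : 2 * s * (x * Q.a * Q'.b + y * Q'.a * Q.b + z * e) - 2 * e =
      4 * (Q.a * Q'.a) * (x * Q'.c + y * Q.c) := by
    linear_combination 2 * e * hxyz + (x * Q.a + y * Q'.a) * he + x * Q.a * hQ'
      + y * Q'.a * hQ - x * Q.a * Q'.b * hb' - y * Q'.a * Q.b * hb'
  refine ⟨x * Q.a * Q'.b + y * Q'.a * Q.b + z * e, ?_, ?_, ?_⟩
  · exact (Int.modEq_iff_dvd.mpr ⟨_, h1⟩).symm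
  · exact (Int.modEq_iff_dvd.mpr ⟨_, h2⟩).symm
  · refine (Int.modEq_iff_dvd.mpr ⟨(x * (s - Q.b) - z * Q.c) * (y * (s - Q'.b) - z * Q'.c)
      + (x * Q'.c + y * Q.c), ?_⟩).symm
    generalize x * Q.a * Q'.b + y * Q'.a * Q.b + z * e = B at *
    linear_combination (B - Q'.b) * h1 + B * hb' + 2 * Q.a * (x * (s - Q.b) - z * Q.c) * h2
      + h3 - he

/-- The integers behind an admissible middle coefficient. -/
theorem IsCompCoeff.exists_eq {D : ℤ} {Q Q' : BinForm} {B : ℤ} (h : Q.IsCompCoeff D Q' B) :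
    ∃ k k' C : ℤ, B = Q.b + 2 * Q.a * k ∧ B = Q'.b + 2 * Q'.a * k' ∧
      B ^ 2 - D = 4 * (Q.a * Q'.a) * C := by
  obtain ⟨h1, h2, h3⟩ := h
  obtain ⟨k, hk⟩ := h1.symm.dvd
  obtain ⟨k', hk'⟩ := h2.symm.dvd
  obtain ⟨C, hC⟩ := h3.symm.dvd
  exact ⟨k, k', C, by linarith, by linarith, hC⟩

/-- The difference of two solutions becomes divisible by 2aa' after multiplication by each of a, a'
and s, which generate the unit ideal. -/
theorem IsCompCoeff.modEq {D : ℤ} {Q Q' : BinForm} (hQ : Q.disc = D) (hQ' : Q'.disc = D)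
    (h : Q.Composable Q') {B B' : ℤ} (hB : Q.IsCompCoeff D Q' B) (hB' : Q.IsCompCoeff D Q' B') :
    B' ≡ B [ZMOD 2 * (Q.a * Q'.a)] := by
  obtain ⟨x, y, z, hxyz⟩ := h.exists_bezout
  have hs := even_b_add (hQ.trans hQ'.symm)
  set s := (Q.b + Q'.b) / 2
  obtain ⟨k, k', C, h1, h2, h3⟩ := hB.exists_eq
  obtain ⟨l, l', C', h1', h2', h3'⟩ := hB'.exists_eq
  have h4 : s * (B - B') = 2 * (Q.a * Q'.a) * ((C - k * k') - (C' - l * l')) := by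
    rw [← mul_right_inj' (two_ne_zero (α := ℤ))]
    linear_combination h3 - h3' - (B - B') * hs - (B - Q.b) * h2 - 2 * Q'.a * k' * h1
      + (B' - Q.b) * h2' + 2 * Q'.a * l' * h1'
  refine Int.modEq_iff_dvd.mpr ⟨x * (k' - l') + y * (k - l) +
    z * ((C - k * k') - (C' - l * l')), ?_⟩
  linear_combination -(B - B') * hxyz + x * Q.a * (h2 - h2') + y * Q'.a * (h1 - h1') + z * h4

theorem dirichletComp_c {D : ℤ} {Q Q' : BinForm} {B C : ℤ} (ha : Q.a * Q'.a ≠ 0)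
    (hC : B ^ 2 - D = 4 * (Q.a * Q'.a) * C) : (Q.dirichletComp D Q' B).c = C := by
  simp only [dirichletComp]
  rw [hC, Int.mul_ediv_cancel_left _ (by simpa using ha)]

theorem dirichletComp_disc {D : ℤ} {Q Q' : BinForm} {B : ℤ} (ha : Q.a * Q'.a ≠ 0)
    (h : Q.IsCompCoeff D Q' B) : (Q.dirichletComp D Q' B).disc = D := by
  obtain ⟨k, k', C, h1, h2, h3⟩ := h.exists_eq
  rw [disc, dirichletComp_c ha h3]
  simp only [dirichletComp]
  linear_combination h3

/-- Translating x turns Q into (a, B, a'C) and Q' into (a', B, aC). A prime dividing aa', B and C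
divides a or a', hence every coefficient of one of these two forms. -/
theorem dirichletComp_isPrimitive {D : ℤ} {Q Q' : BinForm} {B : ℤ} (hQ : Q.disc = D)
    (hQ' : Q'.disc = D) (hp : Q.IsPrimitive) (hp' : Q'.IsPrimitive) (ha : Q.a * Q'.a ≠ 0)
    (h : Q.IsCompCoeff D Q' B) : (Q.dirichletComp D Q' B).IsPrimitive := by
  obtain ⟨k, k', C, h1, h2, h3⟩ := h.exists_eq
  have ha1 := left_ne_zero_of_mul ha
  have ha2 := right_ne_zero_of_mul ha
  simp only [disc] at hQ hQ'
  refine isPrimitive_of_prime ha fun p hpp h4 h5 h6 => ?_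
  rw [dirichletComp_c ha h3] at h6
  simp only [dirichletComp] at h4 h5
  rcases hpp.dvd_or_dvd h4 with h7 | h7
  · have hb : p ∣ Q.b := by
      have : Q.b = B - Q.a * (2 * k) := by linear_combination -h1
      rw [this]; exact dvd_sub h5 (h7.mul_right _)
    refine hp.not_prime_dvd hpp h7 hb ?_
    have : Q.c = C * Q'.a - Q.b * k - Q.a * k ^ 2 := by
      apply mul_left_cancel₀ (mul_ne_zero four_ne_zero ha1)
      linear_combination h3 - (B + Q.b + 2 * Q.a * k) * h1 - hQ
    rw [this]
    exact dvd_sub (dvd_sub (h6.mul_right _) (hb.mul_right _)) (h7.mul_right _)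
  · have hb : p ∣ Q'.b := by
      have : Q'.b = B - Q'.a * (2 * k') := by linear_combination -h2
      rw [this]; exact dvd_sub h5 (h7.mul_right _)
    refine hp'.not_prime_dvd hpp h7 hb ?_
    have : Q'.c = C * Q.a - Q'.b * k' - Q'.a * k' ^ 2 := by
      apply mul_left_cancel₀ (mul_ne_zero four_ne_zero ha2)
      linear_combination h3 - (B + Q'.b + 2 * Q'.a * k') * h2 - hQ'
    rw [this]
    exact dvd_sub (dvd_sub (h6.mul_right _) (hb.mul_right _)) (h7.mul_right _)

end BinForm

/-- Dirichlet composition preserves the set of forms `QF D N`. -/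
theorem QF.exists_eq_dirichletComp {D : ℤ} {N : ℕ} (Q Q' : QF D N) {B : ℤ}
    (h : Q.1.IsCompCoeff D Q'.1 B) : ∃ Q'' : QF D N, Q''.1 = Q.1.dirichletComp D Q'.1 B := by
  obtain ⟨Q, hp, hpos, hd, hN⟩ := Q
  obtain ⟨Q', hp', hpos', hd', hN'⟩ := Q'
  have ha : 0 < Q.a * Q'.a := mul_pos hpos.a_pos hpos'.a_pos
  have hdisc := BinForm.dirichletComp_disc ha.ne' h
  refine ⟨⟨Q.dirichletComp D Q' B, ?_, ?_, hdisc, ?_⟩, rfl⟩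
  · exact BinForm.dirichletComp_isPrimitive hd hd' hp hp' ha.ne' h
  · exact BinForm.isPosDef_of_a_pos ha (by rw [hdisc, ← hd]; exact hpos.disc_neg)
  · rw [← Int.isCoprime_iff_gcd_eq_one] at hN hN' ⊢
    exact hN.mul_left hN'

/-! ### Substitutions, Γ₀(N)-equivalence and representatives with coprime leading coefficients. -/

namespace BinForm

/-- The form `Q(αx + βy, γx + δy)`. -/
def subst (Q : BinForm) (α β γ δ : ℤ) : BinForm :=
  ⟨Q.eval α γ, 2 * Q.a * α * β + Q.b * (α * δ + β * γ) + 2 * Q.c * γ * δ, Q.eval β δ⟩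

theorem subst_eval (Q : BinForm) (α β γ δ x y : ℤ) :
    (Q.subst α β γ δ).eval x y = Q.eval (α * x + β * y) (γ * x + δ * y) := by
  simp only [subst, eval]; ring

theorem subst_disc (Q : BinForm) {α β γ δ : ℤ} (h : α * δ - β * γ = 1) :
    (Q.subst α β γ δ).disc = Q.disc := by
  have : (Q.subst α β γ δ).disc = (α * δ - β * γ) ^ 2 * Q.disc := by
    simp only [subst, disc, eval]; ring
  rw [this, h]; ring

theorem ext_of_eval {Q Q' : BinForm} (h : ∀ x y, Q.eval x y = Q'.eval x y) : Q = Q' := by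
  have h1 := h 1 0
  have h2 := h 0 1
  have h3 := h 1 1
  simp only [eval] at h1 h2 h3
  ext <;> linarith

theorem eq_subst_of_eval {Q Q' : BinForm} {α β γ δ : ℤ}
    (h : ∀ x y : ℤ, Q'.eval x y = Q.eval (α * x + β * y) (γ * x + δ * y)) :
    Q' = Q.subst α β γ δ :=
  ext_of_eval fun x y => by rw [h, subst_eval]

theorem equivalent_gamma0_iff {N : ℕ} {Q Q' : BinForm} :
    Equivalent (CongruenceSubgroup.Gamma0 N) Q Q' ↔
      ∃ α β γ δ : ℤ, α * δ - β * γ = 1 ∧ (N : ℤ) ∣ γ ∧ Q' = Q.subst α β γ δ := by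
  constructor
  · rintro ⟨g, hg, h⟩
    refine ⟨g 0 0, g 0 1, g 1 0, g 1 1, ?_, ?_, eq_subst_of_eval h⟩
    · rw [← Matrix.det_fin_two]; exact g.det_coe
    · exact (ZMod.intCast_zmod_eq_zero_iff_dvd _ N).mp (CongruenceSubgroup.Gamma0_mem.mp hg)
  · rintro ⟨α, β, γ, δ, hdet, hN, rfl⟩
    let g : Matrix.SpecialLinearGroup (Fin 2) ℤ :=
      ⟨!![α, β; γ, δ], by rw [Matrix.det_fin_two_of]; exact hdet⟩
    refine ⟨g, CongruenceSubgroup.Gamma0_mem.mpr ?_, fun x y => ?_⟩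
    · exact (ZMod.intCast_zmod_eq_zero_iff_dvd γ N).mpr hN
    · exact Q.subst_eval α β γ δ x y

theorem subst_subst_inv (Q : BinForm) {α β γ δ : ℤ} (h : α * δ - β * γ = 1) :
    (Q.subst α β γ δ).subst δ (-β) (-γ) α = Q := by
  refine ext_of_eval fun x y => ?_
  rw [subst_eval, subst_eval]
  congr 1
  · linear_combination x * h
  · linear_combination y * h

theorem IsPrimitive.subst {Q : BinForm} (hQ : Q.IsPrimitive) {α β γ δ : ℤ}
    (h : α * δ - β * γ = 1) : (Q.subst α β γ δ).IsPrimitive := by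
  rw [isPrimitive_iff] at hQ ⊢
  intro d ⟨k1, h1⟩ ⟨k2, h2⟩ ⟨k3, h3⟩
  have key := Q.subst_subst_inv h
  generalize Q.subst α β γ δ = P at *
  subst key
  refine hQ d ⟨k1 * δ ^ 2 - k2 * δ * γ + k3 * γ ^ 2, ?_⟩
    ⟨-2 * k1 * δ * β + k2 * (δ * α + β * γ) - 2 * k3 * γ * α, ?_⟩
    ⟨k1 * β ^ 2 - k2 * β * α + k3 * α ^ 2, ?_⟩ <;>
  · simp only [BinForm.subst, eval, h1, h2, h3]; ring

theorem IsPosDef.subst {Q : BinForm} (hQ : Q.IsPosDef) {α β γ δ : ℤ}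
    (h : α * δ - β * γ = 1) : (Q.subst α β γ δ).IsPosDef := by
  intro x y hxy
  rw [subst_eval]
  apply hQ
  intro h0
  rw [Prod.mk.injEq] at h0
  apply hxy
  rw [Prod.mk.injEq]
  constructor
  · linear_combination -x * h + δ * h0.1 - β * h0.2
  · linear_combination -y * h - γ * h0.1 + α * h0.2

/-- A primitive form represents an integer prime to any given nonzero integer. -/
theorem IsPrimitive.exists_isCoprime_eval {Q : BinForm} (hQ : Q.IsPrimitive) (M : ℕ)
    (hM : M ≠ 0) : ∃ x y : ℤ, IsCoprime (Q.eval x y) (M : ℤ) := by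
  induction M using induction_on_primes with
  | zero => exact absurd rfl hM
  | one => exact ⟨0, 0, by simpa using isCoprime_one_right⟩
  | prime_mul p m hp ih =>
    have hm : m ≠ 0 := by rintro rfl; simp at hM
    obtain ⟨x, y, hxy⟩ := ih hm
    have hpp : Prime (p : ℤ) := Nat.prime_iff_prime_int.mp hp
    by_cases hpm : p ∣ m
    · refine ⟨x, y, ?_⟩
      push_cast
      refine IsCoprime.mul_right ?_ hxy
      exact hxy.of_isCoprime_of_dvd_right (Int.natCast_dvd_natCast.mpr hpm)
    -- The values at (1,0), (0,1) and (1,1) recover a, c and b, so p cannot divide all three.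
    · obtain ⟨x', y', hxy'⟩ : ∃ x y : ℤ, ¬ (p : ℤ) ∣ Q.eval x y := by
        by_contra! hcon
        have h1 := hcon 1 0
        have h2 := hcon 0 1
        have h3 := hcon 1 1
        simp only [eval] at h1 h2 h3
        refine hQ.not_prime_dvd hpp (by simpa using h1) ?_ (by simpa using h2)
        have := dvd_sub (dvd_sub h3 h1) h2
        ring_nf at this
        exact this
      have hcop : IsCoprime (p : ℤ) (m : ℤ) :=
        Nat.isCoprime_iff_coprime.mpr ((Nat.Prime.coprime_iff_not_dvd hp).mpr hpm)
      obtain ⟨u, v, huv⟩ := hcop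
      -- Chinese remainder: up + vm = 1, so this point is (x, y) mod m and (x', y') mod p.
      refine ⟨x * (u * p) + x' * (v * m), y * (u * p) + y' * (v * m), ?_⟩
      have e1 : ∃ k, Q.eval (x * (u * p) + x' * (v * m)) (y * (u * p) + y' * (v * m)) =
          Q.eval x y + m * k := by
        have hu : u * p = 1 - v * m := by linear_combination huv
        rw [hu]
        exact ⟨v * (Q.a * (x' - x) * (2 * x + (x' - x) * (v * m)) + Q.b * ((x' - x) * y +
          x * (y' - y) + (x' - x) * (y' - y) * (v * m)) +
          Q.c * (y' - y) * (2 * y + (y' - y) * (v * m))), by simp only [eval]; ring⟩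
      have e2 : ∃ k, Q.eval (x * (u * p) + x' * (v * m)) (y * (u * p) + y' * (v * m)) =
          Q.eval x' y' + p * k := by
        have hu : v * m = 1 - u * p := by linear_combination huv
        rw [hu]
        exact ⟨u * (Q.a * (x - x') * (2 * x' + (x - x') * (u * p)) + Q.b * ((x - x') * y' +
          x' * (y - y') + (x - x') * (y - y') * (u * p)) +
          Q.c * (y - y') * (2 * y' + (y - y') * (u * p))), by simp only [eval]; ring⟩
      push_cast
      refine IsCoprime.mul_right ?_ ?_
      · obtain ⟨k, hk⟩ := e2
        rw [hk, IsCoprime.add_mul_left_left_iff]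
        exact ((Prime.coprime_iff_not_dvd hpp).mpr hxy').symm
      · obtain ⟨k, hk⟩ := e1
        rw [hk, IsCoprime.add_mul_left_left_iff]
        exact hxy

/-- The form `Q(x, Ny)` is primitive if `Q` is and `N` is prime to the leading coefficient. -/
theorem IsPrimitive.scale {Q : BinForm} (hQ : Q.IsPrimitive) (ha : Q.a ≠ 0) {N : ℤ}
    (hN : IsCoprime Q.a N) : (⟨Q.a, Q.b * N, Q.c * N ^ 2⟩ : BinForm).IsPrimitive := by
  refine isPrimitive_of_prime ha fun p hp h1 h2 h3 => ?_
  have hpN : ¬ p ∣ N := fun h => hp.not_isUnit (hN.isUnit_of_dvd' h1 h)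
  refine hQ.not_prime_dvd hp h1 ((hp.dvd_or_dvd h2).resolve_right hpN)
    ((hp.dvd_or_dvd h3).resolve_right fun h => hpN (hp.dvd_of_dvd_pow h))

end BinForm

/-- Each `Γ₀(N)`-class contains a form whose leading coefficient is prime to a given integer. -/
theorem QF.exists_equiv_coprime {D : ℤ} {N : ℕ} (hN : 0 < N) (Q : QF D N) (M : ℕ) (hM : M ≠ 0) :
    ∃ Q' : QF D N, Q ≈ Q' ∧ IsCoprime Q'.1.a (M : ℤ) := by
  obtain ⟨Q, hp, hpos, hd, hQN⟩ := Q
  rw [← Int.isCoprime_iff_gcd_eq_one] at hQN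
  -- Representing by Q(x, Ny) keeps the second argument divisible by N. In the modulus 2MN, the
  -- factor N keeps the new leading coefficient prime to N, and the factor 2 excludes the point (0,
  -- 0), whose value 0 would be prime to M and N when both are 1.
  obtain ⟨x, y, hxy⟩ := (hp.scale hpos.a_pos.ne' hQN).exists_isCoprime_eval (2 * M * N)
    (by positivity)
  have hval : (⟨Q.a, Q.b * N, Q.c * (N : ℤ) ^ 2⟩ : BinForm).eval x y = Q.eval x (N * y) := by
    simp only [BinForm.eval]; ring
  rw [hval] at hxy
  push_cast at hxy
  have hNcop : IsCoprime (Q.eval x (N * y)) (N : ℤ) := hxy.of_mul_right_right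
  have hMcop : IsCoprime (Q.eval x (N * y)) (M : ℤ) := hxy.of_mul_right_left.of_mul_right_right
  have h2cop : IsCoprime (Q.eval x (N * y)) 2 := hxy.of_mul_right_left.of_mul_right_left
  have hg0 : Int.gcd x (N * y) ≠ 0 := by
    intro h0
    rw [Int.gcd_eq_zero_iff] at h0
    rw [h0.1, h0.2] at h2cop
    simp [BinForm.eval, Int.isCoprime_iff_gcd_eq_one] at h2cop
  set g : ℤ := ((Int.gcd x (N * y) : ℕ) : ℤ) with hg
  have hg0' : g ≠ 0 := by rw [hg]; exact_mod_cast hg0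
  obtain ⟨α, hα⟩ : g ∣ x := Int.gcd_dvd_left _ _
  obtain ⟨γ, hγ⟩ : g ∣ N * y := Int.gcd_dvd_right _ _
  have hev : Q.eval x (N * y) = g ^ 2 * Q.eval α γ := by
    rw [hγ]; nth_rewrite 1 [hα]
    simp only [BinForm.eval]; ring
  have hcop : IsCoprime α γ := by
    have h1 := Int.gcd_eq_gcd_ab x (N * y)
    refine ⟨Int.gcdA x (N * y), Int.gcdB x (N * y), ?_⟩
    apply mul_left_cancel₀ hg0'
    rw [← hg] at h1
    linear_combination -h1 - Int.gcdA x (N * y) * hα - Int.gcdB x (N * y) * hγ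
  -- Here Ny = gγ, and g is prime to N because g² divides a value prime to N.
  have hNγ : (N : ℤ) ∣ γ := by
    rw [hev] at hNcop
    have h1 : IsCoprime g (N : ℤ) := hNcop.of_mul_left_left.of_isCoprime_of_dvd_left
      (dvd_pow_self _ two_ne_zero)
    exact h1.symm.dvd_of_dvd_mul_left ⟨y, hγ.symm⟩
  obtain ⟨u, v, huv⟩ := hcop
  have hdet : α * u - (-v) * γ = 1 := by linear_combination huv
  rw [hev] at hMcop hNcop
  have hA : (Q.subst α (-v) γ u).a = Q.eval α γ := rfl
  refine ⟨⟨Q.subst α (-v) γ u, hp.subst hdet, hpos.subst hdet, (Q.subst_disc hdet).trans hd, ?_⟩,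
    ?_, ?_⟩
  · rw [← Int.isCoprime_iff_gcd_eq_one, hA]
    exact hNcop.of_mul_left_right
  · exact BinForm.equivalent_gamma0_iff.mpr ⟨α, -v, γ, u, hdet, hNγ, rfl⟩
  · exact hMcop.of_mul_left_right

theorem FormClass.exists_coprime_representatives {D : ℤ} {N : ℕ} (hN : 0 < N)
    (X Y : FormClass D N) : ∃ Q Q' : QF D N,
      FormClass.mk Q = X ∧ FormClass.mk Q' = Y ∧ Int.gcd Q.1.a Q'.1.a = 1 := by
  induction X using Quotient.inductionOn with | _ Q
  induction Y using Quotient.inductionOn with | _ Q'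
  have ha := Q.2.2.1.a_pos
  obtain ⟨P, hP, hcop⟩ := Q'.exists_equiv_coprime hN Q.1.a.natAbs (by omega)
  refine ⟨Q, P, rfl, (Quotient.sound hP).symm, ?_⟩
  rw [← Int.isCoprime_iff_gcd_eq_one]
  rw [Int.natCast_natAbs, abs_of_pos ha] at hcop
  exact hcop.symm

/-! ### The lattices ℤ + ℤτ as fractional ideals of a quadratic order. -/

namespace FractionalIdeal

variable {K : Type*} [Field K] {O : Subring K}

theorem intCast_mul_mem (I : FractionalIdeal O⁰ K) (m : ℤ) {x : K} (hx : x ∈ I) :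
    (m : K) * x ∈ I := by
  have := Submodule.smul_mem (I : Submodule O K) (m : O) hx
  simpa [Algebra.smul_def] using this

theorem mul_mem_of_mem (I : FractionalIdeal O⁰ K) {y x : K} (hy : y ∈ O) (hx : x ∈ I) :
    y * x ∈ I :=
  Submodule.smul_mem (I : Submodule O K) (⟨y, hy⟩ : O) hx

theorem add_mem_of_mem (I : FractionalIdeal O⁰ K) {x y : K} (hx : x ∈ I) (hy : y ∈ I) :
    x + y ∈ I :=
  Submodule.add_mem (I : Submodule O K) hx hy

theorem isUnit_spanSingleton [IsFractionRing O K] {x : K} (hx : x ≠ 0) :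
    IsUnit (FractionalIdeal.spanSingleton O⁰ x) :=
  IsUnit.of_mul_eq_one (FractionalIdeal.spanSingleton O⁰ x⁻¹) (by
    rw [FractionalIdeal.spanSingleton_mul_spanSingleton, mul_inv_cancel₀ hx,
      FractionalIdeal.spanSingleton_one])

end FractionalIdeal

/-- `O = ℤ + ℤ (D + δ)/2` with `δ² = D < 0` is the order of discriminant `D` in the imaginary
quadratic field `K = ℚ(δ)`. -/
structure IsQuadOrder {K : Type*} [Field K] (O : Subring K) (D : ℤ) (δ : K) : Prop where
  neg : D < 0
  -- This encodes D ≡ 0, 1 mod 4, and makes ω = (D + δ)/2 integral through ω² = Dω − e.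
  mod_four : ∃ e : ℤ, D ^ 2 - D = 4 * e
  sq : δ ^ 2 = D
  mem_iff : ∀ x, x ∈ O ↔ ∃ m n : ℤ, x = m + n * ((D + δ) / 2)
  exists_rep : ∀ x : K, ∃ k m n : ℤ, k ≠ 0 ∧ k * x = m + n * δ

/-- The root `(-b + δ) / 2a` of `Q(x, 1)`. -/
def BinForm.root {K : Type*} [Field K] (δ : K) (Q : BinForm) : K :=
  (-(Q.b : K) + δ) / (2 * (Q.a : K))

/-- The fractional ideal generated by `1` and the root of `Q(x, 1)`. -/
noncomputable def rootIdeal {K : Type*} [Field K] (O : Subring K) [IsFractionRing O K] (δ : K)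
    (Q : BinForm) : FractionalIdeal O⁰ K :=
  1 + FractionalIdeal.spanSingleton O⁰ (Q.root δ)

section RootIdeal

variable {K : Type*} [Field K] {O : Subring K} {δ : K} [IsFractionRing O K]

theorem one_mem_rootIdeal (Q : BinForm) : (1 : K) ∈ rootIdeal O δ Q := by
  rw [rootIdeal, FractionalIdeal.mem_add]
  exact ⟨1, FractionalIdeal.one_mem_one _, 0, FractionalIdeal.zero_mem _ , by simp⟩

theorem root_mem_rootIdeal (Q : BinForm) : Q.root δ ∈ rootIdeal O δ Q := by
  rw [rootIdeal, FractionalIdeal.mem_add]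
  exact ⟨0, FractionalIdeal.zero_mem _, _, FractionalIdeal.mem_spanSingleton_self _ _, by simp⟩

theorem rootIdeal_le_iff (Q : BinForm) (I : FractionalIdeal O⁰ K) :
    rootIdeal O δ Q ≤ I ↔ (1 : K) ∈ I ∧ Q.root δ ∈ I := by
  constructor
  · exact fun hle => ⟨hle (one_mem_rootIdeal Q), hle (root_mem_rootIdeal Q)⟩
  · rintro ⟨h1, h2⟩
    rw [rootIdeal, ← FractionalIdeal.sup_eq_add, sup_le_iff, ← FractionalIdeal.spanSingleton_one,
      FractionalIdeal.spanSingleton_le_iff_mem, FractionalIdeal.spanSingleton_le_iff_mem]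
    exact ⟨h1, h2⟩

end RootIdeal

namespace IsQuadOrder

variable {K : Type*} [Field K] [CharZero K] {O : Subring K} {D : ℤ} {δ : K}

theorem eq_zero (h : IsQuadOrder O D δ) {m n : ℤ} (hmn : (m : K) + n * δ = 0) :
    m = 0 ∧ n = 0 := by
  have h1 : ((m ^ 2 : ℤ) : K) = ((D * n ^ 2 : ℤ) : K) := by
    push_cast
    linear_combination (m - n * δ) * hmn + (n : K) ^ 2 * h.sq
  have h2 : m ^ 2 = D * n ^ 2 := by exact_mod_cast h1
  have hn : n = 0 := by
    by_contra hn
    have : 0 < n ^ 2 := by positivity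
    nlinarith [h.neg, sq_nonneg m]
  subst hn
  simpa using h2

theorem eq_of_eq (h : IsQuadOrder O D δ) {m n m' n' : ℤ}
    (hmn : (m : K) + n * δ = m' + n' * δ) : m = m' ∧ n = n' := by
  have := h.eq_zero (m := m - m') (n := n - n') (by push_cast; linear_combination hmn)
  omega

theorem isFractionRing (h : IsQuadOrder O D δ) : IsFractionRing O K where
  map_units := by
    rintro ⟨y, hy⟩
    have hy0 : y ≠ 0 := nonZeroDivisors.ne_zero hy
    have : (y : K) ≠ 0 := by simpa using hy0
    exact this.isUnit
  surj := by
    intro z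
    obtain ⟨k, m, n, hk, hz⟩ := h.exists_rep z
    have hmem : (m : K) + n * δ ∈ O :=
      (h.mem_iff _).mpr ⟨m - n * D, 2 * n, by push_cast; ring⟩
    refine ⟨(⟨_, hmem⟩, ⟨⟨(k : K), intCast_mem O k⟩, ?_⟩), ?_⟩
    · refine mem_nonZeroDivisors_of_ne_zero ?_
      intro h0
      exact hk (by simpa using congrArg (Subtype.val : O → K) h0)
    · change z * (k : K) = (m : K) + n * δ
      rw [mul_comm, hz]
  exists_of_eq := by
    intro x y hxy
    exact ⟨1, by simpa using hxy⟩

section Root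

variable {Q : BinForm}

theorem two_a_mul_root (ha : Q.a ≠ 0) : 2 * (Q.a : K) * Q.root δ = -Q.b + δ := by
  have : (Q.a : K) ≠ 0 := by exact_mod_cast ha
  rw [BinForm.root]; field_simp

theorem root_sq (h : IsQuadOrder O D δ) (ha : Q.a ≠ 0) (hd : Q.disc = D) :
    (Q.a : K) * Q.root δ ^ 2 + Q.b * Q.root δ + Q.c = 0 := by
  have haK : (Q.a : K) ≠ 0 := by exact_mod_cast ha
  have h1 := two_a_mul_root (K := K) (δ := δ) ha
  have h2 : ((Q.b : K) ^ 2 - 4 * Q.a * Q.c) = D := by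
    have : ((Q.disc : ℤ) : K) = D := by rw [hd]
    simpa [BinForm.disc] using this
  apply mul_left_cancel₀ (mul_ne_zero (by norm_num : (4 : K) ≠ 0) haK)
  linear_combination (2 * (Q.a : K) * Q.root δ + Q.b + δ) * h1 + h.sq - h2

theorem root_eq_zero (h : IsQuadOrder O D δ) (ha : Q.a ≠ 0) {m n : ℤ}
    (hmn : (m : K) + n * Q.root δ = 0) : m = 0 ∧ n = 0 := by
  have h1 := two_a_mul_root (K := K) (δ := δ) ha
  have h2 := h.eq_zero (m := 2 * Q.a * m - n * Q.b) (n := n) (by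
    push_cast; linear_combination 2 * (Q.a : K) * hmn - n * h1)
  obtain ⟨h2, rfl⟩ := h2
  simpa [ha] using h2

theorem root_eq_of_eq (h : IsQuadOrder O D δ) (ha : Q.a ≠ 0) {m n m' n' : ℤ}
    (hmn : (m : K) + n * Q.root δ = m' + n' * Q.root δ) : m = m' ∧ n = n' := by
  have := h.root_eq_zero ha (m := m - m') (n := n - n') (by push_cast; linear_combination hmn)
  omega

/-- The numbers aτ = (−b + δ)/2 and (D + δ)/2 differ by (b + D)/2, an integer since b ≡ b² ≡ D mod
2. -/
theorem mem_iff_root (h : IsQuadOrder O D δ) (ha : Q.a ≠ 0) (hd : Q.disc = D) (x : K) :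
    x ∈ O ↔ ∃ m n : ℤ, x = m + n * (Q.a * Q.root δ) := by
  have h1 := two_a_mul_root (K := K) (δ := δ) ha
  have h2 : Even (Q.b + D) := by
    have : Q.b + D = Q.b * (Q.b + 1) + 2 * (-2 * Q.a * Q.c) := by
      rw [← hd, BinForm.disc]; ring
    rw [this]
    exact (Int.even_mul_succ_self _).add (even_two_mul _)
  obtain ⟨r, hr⟩ := h2
  have hrK : (Q.b : K) + D = r + r := by exact_mod_cast hr
  rw [h.mem_iff]
  constructor
  · rintro ⟨m, n, rfl⟩
    refine ⟨m + n * r, n, ?_⟩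
    push_cast
    linear_combination (n : K) / 2 * hrK - (n : K) / 2 * h1
  · rintro ⟨m, n, rfl⟩
    refine ⟨m - n * r, n, ?_⟩
    push_cast
    linear_combination (n : K) / 2 * h1 - (n : K) / 2 * hrK

theorem a_mul_root_mem (h : IsQuadOrder O D δ) (ha : Q.a ≠ 0) (hd : Q.disc = D) :
    (Q.a : K) * Q.root δ ∈ O :=
  (h.mem_iff_root ha hd _).mpr ⟨0, 1, by simp⟩

variable [IsFractionRing O K]

/-- The group ℤ + ℤτ is already stable under O = ℤ + ℤaτ, because aτ·τ = −bτ − c. -/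
theorem mem_rootIdeal (h : IsQuadOrder O D δ) (ha : Q.a ≠ 0) (hd : Q.disc = D) (x : K) :
    x ∈ rootIdeal O δ Q ↔ ∃ m n : ℤ, x = m + n * Q.root δ := by
  have hroot := h.root_sq ha hd
  rw [rootIdeal, FractionalIdeal.mem_add]
  constructor
  · rintro ⟨i, hi, j, hj, rfl⟩
    obtain ⟨y, rfl⟩ := (FractionalIdeal.mem_one_iff _).mp hi
    obtain ⟨z, rfl⟩ := (FractionalIdeal.mem_spanSingleton _).mp hj
    obtain ⟨m, n, hy⟩ := (h.mem_iff_root ha hd _).mp y.2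
    obtain ⟨m', n', hz⟩ := (h.mem_iff_root ha hd _).mp z.2
    refine ⟨m - n' * Q.c, n * Q.a + m' - n' * Q.b, ?_⟩
    change (y : K) + (z : K) * Q.root δ = _
    rw [hy, hz]
    push_cast
    linear_combination (n' : K) * hroot
  · rintro ⟨m, n, rfl⟩
    refine ⟨m, ?_, n * Q.root δ, ?_, rfl⟩
    · exact (FractionalIdeal.mem_one_iff _).mpr ⟨(m : O), by simp⟩
    · exact (FractionalIdeal.mem_spanSingleton _).mpr ⟨(n : O), by simp [Algebra.smul_def]⟩

/-- Dirichlet composition corresponds to multiplication of ideals. -/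
theorem rootIdeal_mul_rootIdeal (h : IsQuadOrder O D δ) {Q Q' : BinForm} (ha : Q.a ≠ 0)
    (ha' : Q'.a ≠ 0) (hd : Q.disc = D) (hd' : Q'.disc = D) (hc : Q.Composable Q') {B : ℤ}
    (hB : Q.IsCompCoeff D Q' B) :
    rootIdeal O δ Q * rootIdeal O δ Q' = rootIdeal O δ (Q.dirichletComp D Q' B) := by
  have haa : Q.a * Q'.a ≠ 0 := mul_ne_zero ha ha'
  have haK : (Q.a : K) ≠ 0 := by exact_mod_cast ha
  have haK' : (Q'.a : K) ≠ 0 := by exact_mod_cast ha'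
  obtain ⟨x, y, z, hxyz⟩ := hc.exists_bezout
  have hs := BinForm.even_b_add (hd.trans hd'.symm)
  set s := (Q.b + Q'.b) / 2
  obtain ⟨k, k', C, h1, h2, h3⟩ := hB.exists_eq
  have hd'' := BinForm.dirichletComp_disc haa hB
  have hC := BinForm.dirichletComp_c haa h3
  set P := Q.dirichletComp D Q' B with hP
  have hPa : P.a = Q.a * Q'.a := rfl
  have hPb : P.b = B := rfl
  have hPa0 : P.a ≠ 0 := haa
  have e := two_a_mul_root (K := K) (δ := δ) ha
  have e' := two_a_mul_root (K := K) (δ := δ) ha'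
  have e'' := two_a_mul_root (K := K) (δ := δ) hPa0
  have hsq := h.root_sq hPa0 hd''
  rw [hPa, hPb] at e'' hsq
  rw [hC] at hsq
  push_cast at e'' hsq
  have h1K : (B : K) = Q.b + 2 * Q.a * k := by exact_mod_cast h1
  have h2K : (B : K) = Q'.b + 2 * Q'.a * k' := by exact_mod_cast h2
  have hsK : (Q.b : K) + Q'.b = 2 * s := by exact_mod_cast hs
  have hxK : (x : K) * Q.a + y * Q'.a + z * s = 1 := by exact_mod_cast hxyz
  -- In terms of the root ρ of the composed form, the congruences on B say that both roots lie in ℤ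
  -- + ℤρ, as a'ρ + k and aρ + k'. Their product is −sρ + (kk' − C).
  have r : Q.root δ = Q'.a * P.root δ + k := by
    apply mul_left_cancel₀ (mul_ne_zero two_ne_zero haK)
    linear_combination e - e'' + h1K
  have r' : Q'.root δ = Q.a * P.root δ + k' := by
    apply mul_left_cancel₀ (mul_ne_zero two_ne_zero haK')
    linear_combination e' - e'' + h2K
  have rr : Q.root δ * Q'.root δ = -s * P.root δ + (k * k' - C) := by
    rw [r, r']
    linear_combination hsq - P.root δ / 2 * (h1K + h2K) - P.root δ / 2 * hsK
  apply le_antisymm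
  · rw [FractionalIdeal.mul_le]
    intro i hi j hj
    obtain ⟨m, n, rfl⟩ := (h.mem_rootIdeal ha hd i).mp hi
    obtain ⟨m', n', rfl⟩ := (h.mem_rootIdeal ha' hd' j).mp hj
    refine (h.mem_rootIdeal hPa0 hd'' _).mpr ⟨m * m' + n * m' * k + m * n' * k' +
      n * n' * (k * k' - C), n * m' * Q'.a + m * n' * Q.a - n * n' * s, ?_⟩
    push_cast
    linear_combination (n : K) * m' * r + m * n' * r' + n * n' * rr
  · rw [rootIdeal_le_iff]
    have m1 := FractionalIdeal.mul_mem_mul (one_mem_rootIdeal (O := O) (δ := δ) Q)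
      (one_mem_rootIdeal (O := O) (δ := δ) Q')
    have m2 := FractionalIdeal.mul_mem_mul (one_mem_rootIdeal (O := O) (δ := δ) Q)
      (root_mem_rootIdeal (O := O) (δ := δ) Q')
    have m3 := FractionalIdeal.mul_mem_mul (root_mem_rootIdeal (O := O) (δ := δ) Q)
      (one_mem_rootIdeal (O := O) (δ := δ) Q')
    have m4 := FractionalIdeal.mul_mem_mul (root_mem_rootIdeal (O := O) (δ := δ) Q)
      (root_mem_rootIdeal (O := O) (δ := δ) Q')
    refine ⟨by simpa using m1, ?_⟩
    -- Up to an integer, xτ' + yτ − zττ' equals (xa + ya' + zs)ρ = ρ. This is where composability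
    -- enters.
    have m5 := FractionalIdeal.add_mem_of_mem _
      (FractionalIdeal.add_mem_of_mem _ (FractionalIdeal.intCast_mul_mem _ x m2)
        (FractionalIdeal.intCast_mul_mem _ y m3))
      (FractionalIdeal.add_mem_of_mem _ (FractionalIdeal.intCast_mul_mem _ (-z) m4)
      (FractionalIdeal.intCast_mul_mem _ (-(x * k') - y * k + z * (k * k' - C)) m1))
    convert m5 using 1
    push_cast
    linear_combination -P.root δ * hxK - (x : K) * r' - y * r + z * rr

/-- The form `ax² - bxy + cy²`. -/
def conjForm (Q : BinForm) : BinForm := ⟨Q.a, -Q.b, Q.c⟩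

theorem conjForm_disc (Q : BinForm) : (conjForm Q).disc = Q.disc := by
  simp [conjForm, BinForm.disc]

/-- The second root is τ + b/a and the product of the two roots is −c/a. The product lattice is
therefore a⁻¹ times the span of a, b, c and aτ, which by primitivity is a⁻¹O. -/
theorem rootIdeal_mul_conj (h : IsQuadOrder O D δ) (ha : Q.a ≠ 0) (hd : Q.disc = D)
    (hp : Q.IsPrimitive) :
    rootIdeal O δ Q * rootIdeal O δ (conjForm Q) =
      FractionalIdeal.spanSingleton O⁰ ((Q.a : K)⁻¹) := by
  have haK : (Q.a : K) ≠ 0 := by exact_mod_cast ha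
  obtain ⟨x, y, z, hxyz⟩ := hp.exists_bezout
  have hxK : (x : K) * Q.a + y * Q.b + z * Q.c = 1 := by exact_mod_cast hxyz
  have hsq := h.root_sq ha hd
  have e : Q.root δ = Q.a * Q.root δ * (Q.a : K)⁻¹ := by field_simp
  have r' : (conjForm Q).root δ = Q.root δ + Q.b * (Q.a : K)⁻¹ := by
    simp only [conjForm, BinForm.root]; push_cast; field_simp; ring
  have rr : Q.root δ * (conjForm Q).root δ = -Q.c * (Q.a : K)⁻¹ := by
    rw [r']; field_simp; linear_combination hsq
  have hz : ∀ m : ℤ, (m : K) * (Q.a : K)⁻¹ ∈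
      FractionalIdeal.spanSingleton O⁰ ((Q.a : K)⁻¹) := fun m =>
    FractionalIdeal.intCast_mul_mem _ m (FractionalIdeal.mem_spanSingleton_self _ _)
  have hr : Q.root δ ∈ FractionalIdeal.spanSingleton O⁰ ((Q.a : K)⁻¹) := by
    rw [e]
    exact FractionalIdeal.mul_mem_of_mem _ (h.a_mul_root_mem ha hd)
      (FractionalIdeal.mem_spanSingleton_self _ _)
  apply le_antisymm
  · rw [FractionalIdeal.mul_le]
    intro i hi j hj
    obtain ⟨m, n, rfl⟩ := (h.mem_rootIdeal ha hd i).mp hi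
    obtain ⟨m', n', rfl⟩ := (h.mem_rootIdeal (Q := conjForm Q) ha
      ((conjForm_disc Q).trans hd) j).mp hj
    have : (↑m + ↑n * Q.root δ) * (↑m' + ↑n' * (conjForm Q).root δ) =
        ((n * m' + m * n' : ℤ) : K) * Q.root δ +
          ((m * m' * Q.a + m * n' * Q.b - n * n' * Q.c : ℤ) : K) * (Q.a : K)⁻¹ := by
      have : (Q.a : K) * (Q.a : K)⁻¹ = 1 := mul_inv_cancel₀ haK
      push_cast
      linear_combination (m : K) * n' * r' + n * n' * rr - m * m' * this
    rw [this]
    exact FractionalIdeal.add_mem_of_mem _ (FractionalIdeal.intCast_mul_mem _ _ hr) (hz _)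
  · rw [FractionalIdeal.spanSingleton_le_iff_mem]
    have m1 := FractionalIdeal.mul_mem_mul (one_mem_rootIdeal (O := O) (δ := δ) Q)
      (one_mem_rootIdeal (O := O) (δ := δ) (conjForm Q))
    have m2 := FractionalIdeal.mul_mem_mul (one_mem_rootIdeal (O := O) (δ := δ) Q)
      (root_mem_rootIdeal (O := O) (δ := δ) (conjForm Q))
    have m3 := FractionalIdeal.mul_mem_mul (root_mem_rootIdeal (O := O) (δ := δ) Q)
      (one_mem_rootIdeal (O := O) (δ := δ) (conjForm Q))
    have m4 := FractionalIdeal.mul_mem_mul (root_mem_rootIdeal (O := O) (δ := δ) Q)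
      (root_mem_rootIdeal (O := O) (δ := δ) (conjForm Q))
    have m5 := FractionalIdeal.add_mem_of_mem _
      (FractionalIdeal.add_mem_of_mem _ (FractionalIdeal.intCast_mul_mem _ x m1)
        (FractionalIdeal.intCast_mul_mem _ y m2))
      (FractionalIdeal.add_mem_of_mem _ (FractionalIdeal.intCast_mul_mem _ (-y) m3)
      (FractionalIdeal.intCast_mul_mem _ (-z) m4))
    convert m5 using 1
    rw [rr, r']
    field_simp
    push_cast
    linear_combination -hxK

theorem isUnit_rootIdeal (h : IsQuadOrder O D δ) (ha : Q.a ≠ 0) (hd : Q.disc = D)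
    (hp : Q.IsPrimitive) : IsUnit (rootIdeal O δ Q) := by
  have haK : (Q.a : K) ≠ 0 := by exact_mod_cast ha
  have := FractionalIdeal.isUnit_spanSingleton (O := O) (inv_ne_zero haK)
  rw [← h.rootIdeal_mul_conj ha hd hp] at this
  exact isUnit_of_mul_isUnit_left this

/-- If d divides a, b and c, then (a/d)τ preserves ℤ + ℤτ. Properness puts it in O = ℤ + ℤaτ, so a
divides a/d. -/
theorem isPrimitive_of_isProperIdeal (h : IsQuadOrder O D δ) (ha : Q.a ≠ 0) (hd : Q.disc = D)
    (hp : IsProperIdeal (rootIdeal O δ Q)) : Q.IsPrimitive := by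
  rw [BinForm.isPrimitive_iff]
  rintro d ⟨a', ha'⟩ ⟨b', hb'⟩ ⟨c', hc'⟩
  have hd0 : d ≠ 0 := by rintro rfl; simp at ha'; exact ha ha'
  have hdK : (d : K) ≠ 0 := by exact_mod_cast hd0
  have hsq := h.root_sq ha hd
  rw [ha', hb', hc'] at hsq
  push_cast at hsq
  have hsq' : (a' : K) * Q.root δ ^ 2 + b' * Q.root δ + c' = 0 := by
    apply mul_left_cancel₀ hdK
    linear_combination hsq
  have hmem : (a' : K) * Q.root δ ∈ {α : K | ∀ x ∈ rootIdeal O δ Q, α * x ∈ rootIdeal O δ Q} := by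
    intro x hx
    obtain ⟨m, n, rfl⟩ := (h.mem_rootIdeal ha hd x).mp hx
    refine (h.mem_rootIdeal ha hd _).mpr ⟨-n * c', m * a' - n * b', ?_⟩
    push_cast
    linear_combination (n : K) * hsq'
  rw [hp] at hmem
  obtain ⟨m, n, hmn⟩ := (h.mem_iff_root ha hd _).mp hmem
  have := h.root_eq_of_eq ha (m := 0) (n := a') (m' := m) (n' := n * Q.a) (by
    push_cast; linear_combination hmn)
  have h2 : a' * 1 = a' * (n * d) := by linear_combination this.2 + n * ha'
  have ha0 : a' ≠ 0 := by rintro rfl; simp at ha'; exact ha ha'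
  exact isUnit_of_dvd_one ⟨n, by linarith [mul_left_cancel₀ ha0 h2]⟩

end Root

end IsQuadOrder

/-! ### Normal form of ideals; proper ideals are invertible. -/

theorem Ideal.exists_nonneg_mem_iff_dvd (I : Ideal ℤ) : ∃ n : ℤ, 0 ≤ n ∧ ∀ x, x ∈ I ↔ n ∣ x := by
  obtain ⟨s, hs⟩ := (IsPrincipalIdealRing.principal I).principal
  refine ⟨|s|, abs_nonneg s, fun x => ?_⟩
  rw [abs_dvd, hs]
  exact Ideal.mem_span_singleton

section Proper

variable {K : Type*} [Field K] {O : Subring K} [IsFractionRing O K]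

theorem isProperIdeal_spanSingleton_mul {x : K} (hx : x ≠ 0) (I : FractionalIdeal O⁰ K) :
    IsProperIdeal (FractionalIdeal.spanSingleton O⁰ x * I) ↔ IsProperIdeal I := by
  unfold IsProperIdeal
  have : {α : K | ∀ y ∈ FractionalIdeal.spanSingleton O⁰ x * I,
      α * y ∈ FractionalIdeal.spanSingleton O⁰ x * I} = {α : K | ∀ y ∈ I, α * y ∈ I} := by
    ext α
    simp only [Set.mem_ofPred_eq, FractionalIdeal.mem_singleton_mul]
    constructor
    · intro h y hy
      obtain ⟨z, hz, hyz⟩ := h (x * y) ⟨y, hy, rfl⟩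
      have : α * y = z := mul_left_cancel₀ hx (by rw [← hyz]; ring)
      rwa [this]
    · rintro h _ ⟨z, hz, rfl⟩
      exact ⟨α * z, h z hz, by ring⟩
  rw [this]

end Proper

namespace IsQuadOrder

variable {K : Type*} [Field K] [CharZero K] {O : Subring K} {D : ℤ} {δ : K}

/-- The definition of `IsProperIdeal` does not exclude 0, but the multiplier ring of 0 is all of K
and contains 1/2. -/
theorem not_isProperIdeal_zero (h : IsQuadOrder O D δ) :
    ¬ IsProperIdeal (0 : FractionalIdeal O⁰ K) := by
  intro hp
  have h1 : (1 / 2 : K) ∈ (O : Set K) := by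
    rw [← hp]
    intro x hx
    rw [FractionalIdeal.mem_zero_iff] at hx ⊢
    rw [hx, mul_zero]
  obtain ⟨m, n, hmn⟩ := (h.mem_iff _).mp h1
  have := h.eq_of_eq (m := 1) (n := 0) (m' := 2 * m + n * D) (n' := n) (by
    push_cast; linear_combination 2 * hmn)
  obtain ⟨h2, rfl⟩ := this
  omega

variable [IsFractionRing O K]

/-- The normal form of the nonzero ideals of a quadratic order. -/
theorem exists_coeIdeal_eq (h : IsQuadOrder O D δ) (J : Ideal O) (hJ : J ≠ ⊥) :
    ∃ (s : ℤ) (Q : BinForm), 0 < s ∧ 0 < Q.a ∧ Q.disc = D ∧ (J : FractionalIdeal O⁰ K) =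
      FractionalIdeal.spanSingleton O⁰ ((s * Q.a : ℤ) : K) * rootIdeal O δ Q := by
  obtain ⟨e, he⟩ := h.mod_four
  have heK : (D : K) ^ 2 - D = 4 * e := by exact_mod_cast he
  set ω : K := (D + δ) / 2 with hω
  have hωO : ω ∈ O := (h.mem_iff _).mpr ⟨0, 1, by simp [hω]⟩
  have hsq : ω ^ 2 = D * ω - e := by
    rw [hω]; linear_combination h.sq / 4 - heK / 4
  have hindep : ∀ m n : ℤ, (m : K) + n * ω = 0 → m = 0 ∧ n = 0 := by
    intro m n hmn
    have := h.eq_zero (m := 2 * m + n * D) (n := n) (by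
      push_cast; rw [hω] at hmn; linear_combination 2 * hmn)
    obtain ⟨h1, rfl⟩ := this
    simpa using h1
  set I : FractionalIdeal O⁰ K := (J : FractionalIdeal O⁰ K) with hI
  have hI_le : ∀ x ∈ I, x ∈ O := by
    intro x hx
    obtain ⟨y, -, rfl⟩ := (FractionalIdeal.mem_coeIdeal _).mp hx
    exact y.2
  have hadd : ∀ {x y : K}, x ∈ I → y ∈ I → x + y ∈ I := FractionalIdeal.add_mem_of_mem I
  have hmul : ∀ {x y : K}, x ∈ O → y ∈ I → x * y ∈ I := FractionalIdeal.mul_mem_of_mem I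
  have h_smul : ∀ (m : ℤ) {y : K}, y ∈ I → m * y ∈ I := FractionalIdeal.intCast_mul_mem I
  -- `S` is the ideal of ω-coefficients of elements of J and `M` is J ∩ ℤ. Their generators s and m₀
  -- = sa give the ℤ-basis sa, s(r' + ω) of J.
  let S : Ideal ℤ :=
    { carrier := {n | ∃ m : ℤ, (m : K) + n * ω ∈ I}
      zero_mem' := ⟨0, by simp [FractionalIdeal.zero_mem]⟩
      add_mem' := by
        rintro n n' ⟨m, hm⟩ ⟨m', hm'⟩
        refine ⟨m + m', ?_⟩
        convert hadd hm hm' using 1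
        push_cast; ring
      smul_mem' := by
        rintro k n ⟨m, hm⟩
        refine ⟨k * m, ?_⟩
        convert h_smul k hm using 1
        rw [smul_eq_mul]; push_cast; ring }
  let M : Ideal ℤ :=
    { carrier := {m | (m : K) ∈ I}
      zero_mem' := by simp [FractionalIdeal.zero_mem]
      add_mem' := by
        intro n n' hm hm'
        have := hadd hm hm'
        simpa using this
      smul_mem' := by
        intro k n hm
        have := h_smul k hm
        simpa using this }
  obtain ⟨s, hs0, hs⟩ := S.exists_nonneg_mem_iff_dvd
  obtain ⟨m₀, hm0, hm⟩ := M.exists_nonneg_mem_iff_dvd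
  have hS : ∀ n : ℤ, (∃ m : ℤ, (m : K) + n * ω ∈ I) ↔ s ∣ n := hs
  have hM : ∀ m : ℤ, (m : K) ∈ I ↔ m₀ ∣ m := hm
  -- The norm of a nonzero element of J is a nonzero integer in J.
  have hm0' : m₀ ≠ 0 := by
    obtain ⟨x, hxJ, hx0⟩ := Submodule.exists_mem_ne_zero_of_ne_bot hJ
    obtain ⟨m, n, hmn⟩ := (h.mem_iff _).mp x.2
    have hxI : (x : K) ∈ I := (FractionalIdeal.mem_coeIdeal _).mpr ⟨x, hxJ, rfl⟩
    have hx0' : (x : K) ≠ 0 := by simpa using hx0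
    have hconj : ((m + n * D : ℤ) : K) + (-n : ℤ) * ω ∈ O :=
      (h.mem_iff _).mpr ⟨m + n * D, -n, rfl⟩
    have hprod := hmul hconj hxI
    have heq : (((m + n * D : ℤ) : K) + (-n : ℤ) * ω) * x =
        ((m ^ 2 + m * n * D + n ^ 2 * e : ℤ) : K) := by
      rw [hmn]; push_cast; linear_combination -(n : K) ^ 2 * hsq
    rintro rfl
    have hne : ((m + n * D : ℤ) : K) + (-n : ℤ) * ω ≠ 0 := by
      intro h0
      obtain ⟨h1, h2⟩ := hindep _ _ h0
      have hn : n = 0 := by omega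
      subst hn
      have hm' : m = 0 := by simpa using h1
      subst hm'
      exact hx0' (by rw [hmn]; simp)
    have hne' := mul_ne_zero hne hx0'
    rw [heq] at hprod hne'
    rw [hM, zero_dvd_iff] at hprod
    rw [hprod] at hne'
    exact hne' (by simp)
  obtain ⟨a, ha⟩ : s ∣ m₀ := by
    rw [← hS]
    refine ⟨0, ?_⟩
    have := hmul hωO ((hM m₀).mpr dvd_rfl)
    convert this using 1
    push_cast; ring
  obtain ⟨r, hr⟩ := (hS s).mpr dvd_rfl
  obtain ⟨r', rfl⟩ : s ∣ r := by
    have h1 : s ∣ r + s * D := by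
      rw [← hS]
      refine ⟨-(s * e), ?_⟩
      convert hmul hωO hr using 1
      push_cast
      linear_combination -(s : K) * hsq
    exact (Int.dvd_iff_dvd_of_dvd_add h1).mpr (Dvd.intro _ rfl)
  have hspos : 0 < s := lt_of_le_of_ne hs0 (by rintro rfl; simp at ha; exact hm0' ha)
  have hapos : 0 < a := by
    have h1 : 0 < m₀ := lt_of_le_of_ne hm0 hm0'.symm
    rw [ha] at h1
    exact pos_of_mul_pos_right h1 hs0
  -- Multiplying s(r' + ω) by the conjugate of r' + ω gives an integer in J, hence a multiple of sa.
  obtain ⟨c, hc⟩ : a ∣ r' ^ 2 + r' * D + e := by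
    have h1 : ((s * (r' ^ 2 + r' * D + e) : ℤ) : K) ∈ I := by
      have hconj : ((r' + D : ℤ) : K) + (-1 : ℤ) * ω ∈ O := (h.mem_iff _).mpr ⟨r' + D, -1, rfl⟩
      convert hmul hconj hr using 1
      push_cast; linear_combination (s : K) * hsq
    rw [hM, ha] at h1
    exact (mul_dvd_mul_iff_left hspos.ne').mp h1
  have hdisc : (⟨a, -(2 * r' + D), c⟩ : BinForm).disc = D := by
    simp only [BinForm.disc]; linear_combination he + 4 * hc
  -- The middle coefficient is chosen so that aτ = r' + ω.
  refine ⟨s, ⟨a, -(2 * r' + D), c⟩, hspos, hapos, hdisc, ?_⟩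
  have haK : (a : K) ≠ 0 := by exact_mod_cast hapos.ne'
  have hroot : (a : K) * (⟨a, -(2 * r' + D), c⟩ : BinForm).root δ = r' + ω := by
    simp only [BinForm.root, hω]; push_cast; field_simp; ring
  apply FractionalIdeal.ext
  intro x
  rw [FractionalIdeal.mem_singleton_mul]
  constructor
  · intro hx
    obtain ⟨m, n, hmn⟩ := (h.mem_iff _).mp (hI_le x hx)
    rw [hmn] at hx
    obtain ⟨n', rfl⟩ := (hS n).mp ⟨m, hx⟩
    have h1 : ((m - n' * (s * r') : ℤ) : K) ∈ I := by
      convert hadd hx (h_smul (-n') hr) using 1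
      push_cast; ring
    obtain ⟨k, hk⟩ := (hM _).mp h1
    rw [ha] at hk
    have hkK : (m : K) - n' * (s * r') = s * a * k := by exact_mod_cast hk
    refine ⟨k + n' * BinForm.root δ _, (h.mem_rootIdeal hapos.ne' hdisc _).mpr ⟨k, n', rfl⟩, ?_⟩
    rw [hmn]
    push_cast
    linear_combination hkK - (n' : K) * s * hroot
  · rintro ⟨y, hy, rfl⟩
    obtain ⟨m, n, rfl⟩ := (h.mem_rootIdeal hapos.ne' hdisc _).mp hy
    convert hadd (h_smul m ((hM m₀).mpr dvd_rfl)) (h_smul n hr) using 1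
    rw [ha]
    push_cast
    linear_combination (n : K) * s * hroot

theorem exists_eq_spanSingleton_mul_rootIdeal (h : IsQuadOrder O D δ) (I : FractionalIdeal O⁰ K)
    (hI : I ≠ 0) : ∃ (x : K) (Q : BinForm), x ≠ 0 ∧ 0 < Q.a ∧ Q.disc = D ∧
      I = FractionalIdeal.spanSingleton O⁰ x * rootIdeal O δ Q := by
  obtain ⟨d, J, hd, hIJ⟩ := FractionalIdeal.exists_eq_spanSingleton_mul I
  have hJ : J ≠ ⊥ := by
    rintro rfl
    exact hI (by rw [hIJ]; simp)
  obtain ⟨s, Q, hs, ha, hQ, hJQ⟩ := h.exists_coeIdeal_eq J hJ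
  have hd' : (algebraMap O K d) ≠ 0 := by simpa using hd
  refine ⟨(algebraMap O K d)⁻¹ * ((s * Q.a : ℤ) : K), Q, ?_, ha, hQ, ?_⟩
  · exact mul_ne_zero (inv_ne_zero hd') (by exact_mod_cast (mul_pos hs ha).ne')
  · rw [hIJ, hJQ, ← mul_assoc, FractionalIdeal.spanSingleton_mul_spanSingleton]

/-- In a quadratic order the proper fractional ideals are the invertible ones. -/
theorem isProperIdeal_iff_isUnit (h : IsQuadOrder O D δ) (I : FractionalIdeal O⁰ K) :
    IsProperIdeal I ↔ IsUnit I := by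
  refine ⟨fun hp => ?_, IsProperIdeal.of_isUnit⟩
  have hI : I ≠ 0 := by rintro rfl; exact h.not_isProperIdeal_zero hp
  obtain ⟨x, Q, hx, ha, hQ, rfl⟩ := h.exists_eq_spanSingleton_mul_rootIdeal I hI
  rw [isProperIdeal_spanSingleton_mul hx] at hp
  exact (FractionalIdeal.isUnit_spanSingleton hx).mul
    (h.isUnit_rootIdeal ha.ne' hQ (h.isPrimitive_of_isProperIdeal ha.ne' hQ hp))

end IsQuadOrder

/-! ### Principal ideals with a generator congruent to an integer mod N. -/

/-- `x` is congruent modulo `N O` to an integer prime to `N`. -/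
def IsCongrInt {K : Type*} [Field K] (O : Subring K) (N : ℕ) (x : K) : Prop :=
  ∃ a : ℤ, IsCoprime a (N : ℤ) ∧ ∃ z ∈ O, x = a + N * z

section Principal

variable {K : Type*} [Field K] {O : Subring K} {N : ℕ}

theorem IsCongrInt.mul {x y : K} (hx : IsCongrInt O N x) (hy : IsCongrInt O N y) :
    IsCongrInt O N (x * y) := by
  obtain ⟨a, ha, z, hz, rfl⟩ := hx
  obtain ⟨b, hb, w, hw, rfl⟩ := hy
  refine ⟨a * b, ha.mul_left hb, a * w + b * z + N * z * w, ?_, by push_cast; ring⟩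
  exact O.add_mem (O.add_mem (O.mul_mem (intCast_mem O a) hw) (O.mul_mem (intCast_mem O b) hz))
    (O.mul_mem (O.mul_mem (natCast_mem O N) hz) hw)

theorem isCongrInt_intCast {a : ℤ} (ha : IsCoprime a (N : ℤ)) : IsCongrInt O N (a : K) :=
  ⟨a, ha, 0, O.zero_mem, by simp⟩

theorem isCongrInt_one : IsCongrInt O N (1 : K) := by
  simpa using isCongrInt_intCast (O := O) (N := N) (K := K) isCoprime_one_left

variable [IsFractionRing O K]

theorem toPrincipalIdeal_mem_principalGroup₀ {x : Kˣ} (hx : IsCongrInt O N (x : K)) :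
    toPrincipalIdeal O K x ∈ principalGroup₀ O N := by
  obtain ⟨a, ha, z, hz, hx⟩ := hx
  have hxO : (x : K) ∈ O := by
    rw [hx]
    exact O.add_mem (intCast_mem O a) (O.mul_mem (natCast_mem O N) hz)
  refine Subgroup.subset_closure ⟨⟨x, hxO⟩, a, Int.isCoprime_iff_gcd_eq_one.mp ha, ?_, ?_⟩
  · refine Ideal.mem_span_singleton.mpr ⟨⟨z, hz⟩, Subtype.ext ?_⟩
    simp [hx]
  · rw [coe_toPrincipalIdeal, FractionalIdeal.coeIdeal_span_singleton]
    rfl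

/-- The generators are closed under products, so the group they generate consists of their
quotients; inversion swaps x and y. -/
theorem mem_principalGroup₀_iff (u : (FractionalIdeal O⁰ K)ˣ) :
    u ∈ principalGroup₀ O N ↔ ∃ x y : Kˣ, IsCongrInt O N (x : K) ∧ IsCongrInt O N (y : K) ∧
      toPrincipalIdeal O K y * u = toPrincipalIdeal O K x := by
  constructor
  · intro hu
    induction hu using Subgroup.closure_induction with
    | mem u hu =>
      obtain ⟨α, a, ha, hα, hu⟩ := hu
      rw [FractionalIdeal.coeIdeal_span_singleton] at hu
      have hα0 : (α : K) ≠ 0 := by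
        intro h0
        have h1 : algebraMap O K α = 0 := h0
        rw [h1, FractionalIdeal.spanSingleton_zero] at hu
        exact u.ne_zero hu
      refine ⟨Units.mk0 (α : K) hα0, 1, ?_, isCongrInt_one, ?_⟩
      · obtain ⟨z, hz⟩ := Ideal.mem_span_singleton.mp hα
        refine ⟨a, Int.isCoprime_iff_gcd_eq_one.mpr ha, z, z.2, ?_⟩
        have := congrArg (Subtype.val : O → K) hz
        simp only [AddSubgroupClass.coe_sub, Subring.coe_intCast, Subring.coe_mul,
          Subring.coe_natCast] at this
        rw [Units.val_mk0]
        linear_combination this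
      · rw [map_one, one_mul]
        apply Units.ext
        rw [hu, coe_toPrincipalIdeal]
        rfl
    | one => exact ⟨1, 1, isCongrInt_one, isCongrInt_one, by simp⟩
    | mul u v _ _ hu hv =>
      obtain ⟨x, y, hx, hy, hxy⟩ := hu
      obtain ⟨x', y', hx', hy', hxy'⟩ := hv
      refine ⟨x * x', y * y', hx.mul hx', hy.mul hy', ?_⟩
      rw [map_mul, map_mul, ← hxy, ← hxy', mul_mul_mul_comm]
    | inv u _ hu =>
      obtain ⟨x, y, hx, hy, hxy⟩ := hu
      exact ⟨y, x, hy, hx, by rw [← hxy, mul_inv_cancel_right]⟩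
  · rintro ⟨x, y, hx, hy, hxy⟩
    rw [eq_inv_mul_of_mul_eq hxy]
    exact Subgroup.mul_mem _ (Subgroup.inv_mem _ (toPrincipalIdeal_mem_principalGroup₀ hy))
      (toPrincipalIdeal_mem_principalGroup₀ hx)

theorem RingClass₀.mk_eq_mk_iff (u v : idealGroup O N) :
    (QuotientGroup.mk u : RingClass₀ O N) = QuotientGroup.mk v ↔
      ∃ x y : Kˣ, IsCongrInt O N (x : K) ∧ IsCongrInt O N (y : K) ∧
        FractionalIdeal.spanSingleton O⁰ (x : K) * (u.1 : FractionalIdeal O⁰ K) =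
        FractionalIdeal.spanSingleton O⁰ (y : K) * (v.1 : FractionalIdeal O⁰ K) := by
  rw [QuotientGroup.eq, Subgroup.mem_subgroupOf, mem_principalGroup₀_iff]
  refine exists_congr fun x => exists_congr fun y => and_congr_right fun _ =>
    and_congr_right fun _ => ?_
  rw [← coe_toPrincipalIdeal, ← coe_toPrincipalIdeal, ← Units.val_mul, ← Units.val_mul,
    Units.val_inj, Subgroup.coe_mul, Subgroup.coe_inv, mul_left_comm, inv_mul_eq_iff_eq_mul,
    mul_comm u.1, eq_comm]

end Principal

/-! ### The map from form classes to ideal classes: well defined, injective, surjective. -/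

namespace IsQuadOrder

variable {K : Type*} [Field K] [CharZero K] {O : Subring K} {D : ℤ} {δ : K} {N : ℕ}

/-- A unimodular relation between the roots of two forms comes from a substitution. -/
theorem eq_subst_of_root (h : IsQuadOrder O D δ) {Q P : BinForm} (ha : 0 < Q.a) (ha' : 0 < P.a)
    (hd : Q.disc = D) (hd' : P.disc = D) {α β γ d : ℤ}
    (hroot : P.root δ * (γ * Q.root δ + d) = α * Q.root δ + β) (hu : IsUnit (α * d - β * γ)) :
    α * d - β * γ = 1 ∧ P = Q.subst d (-β) (-γ) α := by
  have e := two_a_mul_root (K := K) (δ := δ) ha.ne'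
  have e' := two_a_mul_root (K := K) (δ := δ) ha'.ne'
  -- Clear denominators by 4·`Q.a`·`P.a` and compare coefficients of 1 and δ.
  obtain ⟨h1, h2⟩ := h.eq_of_eq (m := P.b * Q.b * γ + γ * D - 2 * Q.a * d * P.b)
    (n := 2 * Q.a * d - P.b * γ - Q.b * γ)
    (m' := 2 * P.a * (2 * Q.a * β - Q.b * α)) (n' := 2 * P.a * α) (by
      push_cast
      linear_combination 4 * (Q.a : K) * P.a * hroot - (γ : K) * h.sq
        - (2 * Q.a * (γ * Q.root δ + d)) * e' - (γ * (-P.b + δ) - 2 * P.a * α) * e)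
  -- The right side is nonnegative as D < 0, so the determinant cannot be −1. This plays the role of
  -- both roots lying in the upper half plane.
  have hdet0 : 4 * Q.a * P.a * (α * d - β * γ) = (2 * Q.a * d - Q.b * γ) ^ 2 + (-D) * γ ^ 2 := by
    linear_combination γ * h1 - (2 * Q.a * d - Q.b * γ) * h2
  have hnonneg : 0 ≤ 4 * Q.a * P.a * (α * d - β * γ) := by
    rw [hdet0]
    have := h.neg
    have : 0 ≤ -D := by omega
    positivity
  have hdet : α * d - β * γ = 1 := by
    rcases Int.isUnit_iff.mp hu with h3 | h3
    · exact h3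
    · rw [h3] at hnonneg
      nlinarith [mul_pos ha ha']
  refine ⟨hdet, ?_⟩
  simp only [BinForm.disc] at hd hd'
  have hA : P.a = Q.eval d (-γ) := by
    apply mul_left_cancel₀ (mul_ne_zero four_ne_zero ha.ne')
    rw [hdet] at hdet0
    simp only [BinForm.eval]
    linear_combination hdet0 + γ ^ 2 * hd
  have hdb : d * P.b = Q.b * d - 2 * P.a * β - 2 * Q.c * γ := by
    apply mul_left_cancel₀ (mul_ne_zero two_ne_zero ha.ne')
    linear_combination -h1 - Q.b * h2 - γ * hd
  have hB : P.b = (Q.subst d (-β) (-γ) α).b := by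
    simp only [BinForm.subst]
    linear_combination -P.b * hdet + α * hdb + β * h2
  have hC : P.c = (Q.subst d (-β) (-γ) α).c := by
    have hdisc : (Q.subst d (-β) (-γ) α).disc = D := by
      rw [Q.subst_disc (by linear_combination hdet)]; exact hd
    rw [BinForm.disc, ← hB] at hdisc
    have hA' : (Q.subst d (-β) (-γ) α).a = P.a := hA.symm
    rw [hA'] at hdisc
    apply mul_left_cancel₀ (mul_ne_zero four_ne_zero ha'.ne')
    linear_combination hdisc - hd'
  exact BinForm.ext hA hB hC

theorem root_subst (h : IsQuadOrder O D δ) {Q : BinForm} {α β γ d : ℤ} (ha : Q.a ≠ 0)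
    (hd : Q.disc = D) (ha' : (Q.subst α β γ d).a ≠ 0) (hdet : α * d - β * γ = 1) :
    Q.root δ * (γ * (Q.subst α β γ d).root δ + d) = α * (Q.subst α β γ d).root δ + β := by
  have e := two_a_mul_root (K := K) (δ := δ) ha
  have e' := two_a_mul_root (K := K) (δ := δ) ha'
  have haK : (Q.a : K) ≠ 0 := by exact_mod_cast ha
  have haK' : ((Q.subst α β γ d).a : K) ≠ 0 := by exact_mod_cast ha'
  have hdetK : (α : K) * d - β * γ = 1 := by exact_mod_cast hdet
  have hdK : (Q.b : K) ^ 2 - 4 * Q.a * Q.c = D := by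
    rw [← hd, BinForm.disc]; push_cast; ring
  have hA : ((Q.subst α β γ d).a : K) = Q.a * α ^ 2 + Q.b * α * γ + Q.c * γ ^ 2 := by
    simp only [BinForm.subst, BinForm.eval]; push_cast; ring
  have hB : ((Q.subst α β γ d).b : K) =
      2 * Q.a * α * β + Q.b * (α * d + β * γ) + 2 * Q.c * γ * d := by
    simp only [BinForm.subst]; push_cast; ring
  generalize Q.subst α β γ d = P at *
  apply mul_left_cancel₀ (mul_ne_zero (mul_ne_zero (by norm_num : (4 : K) ≠ 0) haK) haK')
  linear_combination (2 * γ * P.a * P.root δ + 2 * P.a * d) * e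
    + ((-Q.b + δ) * γ - 2 * Q.a * α) * e' + γ * h.sq - γ * hdK
    + (2 * d * (-Q.b + δ) - 4 * Q.a * β) * hA + (-γ * (-Q.b + δ) + 2 * Q.a * α) * hB
    + ((2 * Q.a * α + Q.b * γ) * δ - γ * (Q.b ^ 2 - 4 * Q.a * Q.c)) * hdetK

variable [IsFractionRing O K]

/-- With ρ the new root, (γρ + d)·(1, τ) = (γρ + d, αρ + β), a ℤ-basis of ℤ + ℤρ since the
determinant is 1. -/
theorem spanSingleton_mul_rootIdeal_subst (h : IsQuadOrder O D δ) {Q : BinForm} {α β γ d : ℤ}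
    (ha : Q.a ≠ 0) (hd : Q.disc = D) (ha' : (Q.subst α β γ d).a ≠ 0)
    (hdet : α * d - β * γ = 1) :
    FractionalIdeal.spanSingleton O⁰ (γ * (Q.subst α β γ d).root δ + d) * rootIdeal O δ Q =
      rootIdeal O δ (Q.subst α β γ d) := by
  have hr := h.root_subst ha hd ha' hdet
  have hd' := (Q.subst_disc hdet).trans hd
  have hdetK : (α : K) * d - β * γ = 1 := by exact_mod_cast hdet
  generalize Q.subst α β γ d = P at *
  apply FractionalIdeal.ext
  intro x
  rw [FractionalIdeal.mem_singleton_mul, h.mem_rootIdeal ha' hd']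
  constructor
  · rintro ⟨y, hy, rfl⟩
    obtain ⟨m, n, rfl⟩ := (h.mem_rootIdeal ha hd y).mp hy
    exact ⟨m * d + n * β, m * γ + n * α, by push_cast; linear_combination (n : K) * hr⟩
  · rintro ⟨m, n, rfl⟩
    refine ⟨((m * α - n * β : ℤ) : K) + ((n * d - m * γ : ℤ) : K) * Q.root δ,
      (h.mem_rootIdeal ha hd _).mpr ⟨_, _, rfl⟩, ?_⟩
    push_cast
    linear_combination -(n * d - m * γ : K) * hr - (m + n * P.root δ) * hdetK

theorem spanSingleton_a_mul_rootIdeal_eq_coeIdeal (h : IsQuadOrder O D δ) {Q : BinForm}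
    (ha : Q.a ≠ 0) (hd : Q.disc = D) : ∃ J : Ideal O, (Q.a : O) ∈ J ∧
      (J : FractionalIdeal O⁰ K) =
        FractionalIdeal.spanSingleton O⁰ (Q.a : K) * rootIdeal O δ Q := by
  have hle : FractionalIdeal.spanSingleton O⁰ (Q.a : K) * rootIdeal O δ Q ≤ 1 := by
    intro x hx
    obtain ⟨y, hy, rfl⟩ := FractionalIdeal.mem_singleton_mul.mp hx
    obtain ⟨m, n, rfl⟩ := (h.mem_rootIdeal ha hd y).mp hy
    have : (Q.a : K) * (m + n * Q.root δ) ∈ O :=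
      (h.mem_iff_root ha hd _).mpr ⟨Q.a * m, n, by push_cast; ring⟩
    exact (FractionalIdeal.mem_one_iff _).mpr ⟨⟨_, this⟩, rfl⟩
  obtain ⟨J, hJ⟩ := FractionalIdeal.le_one_iff_exists_coeIdeal.mp hle
  refine ⟨J, ?_, hJ⟩
  have h1 : (Q.a : K) ∈ (J : FractionalIdeal O⁰ K) := by
    rw [hJ, FractionalIdeal.mem_singleton_mul]
    exact ⟨1, one_mem_rootIdeal Q, by simp⟩
  obtain ⟨y, hy, hyQ⟩ := (FractionalIdeal.mem_coeIdeal _).mp h1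
  have : y = (Q.a : O) := Subtype.ext (hyQ.trans (by simp))
  rwa [← this]

/-- The lattice need not be integral, but a times it is an ideal containing a, hence prime to N, and
aO itself lies in P₀. -/
theorem mem_idealGroup (h : IsQuadOrder O D δ) {Q : BinForm} (ha : Q.a ≠ 0) (hd : Q.disc = D)
    (hN : IsCoprime Q.a (N : ℤ)) {u : (FractionalIdeal O⁰ K)ˣ}
    (hu : (u : FractionalIdeal O⁰ K) = rootIdeal O δ Q) : u ∈ idealGroup O N := by
  have haK : (Q.a : K) ≠ 0 := by exact_mod_cast ha
  obtain ⟨J, hJa, hJ⟩ := h.spanSingleton_a_mul_rootIdeal_eq_coeIdeal ha hd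
  have h1 : toPrincipalIdeal O K (Units.mk0 _ haK) ∈ idealGroup O N :=
    principalGroup₀_le_idealGroup O N
      (toPrincipalIdeal_mem_principalGroup₀ (isCongrInt_intCast hN))
  refine (Subgroup.mul_mem_cancel_left _ h1).mp (Subgroup.subset_closure ⟨J, ?_, ?_, ?_⟩)
  · rw [hJ, Units.val_mul, coe_toPrincipalIdeal, hu, Units.val_mk0]
  · exact IsProperIdeal.of_isUnit (Units.isUnit _)
  · rw [Ideal.eq_top_iff_one]
    obtain ⟨r, s, hrs⟩ := hN
    have h1 : (1 : O) = (r : O) * (Q.a : O) + (s : O) * (N : O) := by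
      have := congrArg (Int.cast : ℤ → O) hrs
      push_cast at this
      exact this.symm
    rw [h1]
    exact Ideal.add_mem _ (Ideal.mul_mem_left _ _ (Ideal.mem_sup_left hJa))
      (Ideal.mul_mem_left _ _ (Ideal.mem_sup_right (Ideal.mem_span_singleton_self _)))

/-- The ideal `ℤ + ℤ τ_Q` as an element of `I(O, N)`. -/
noncomputable def formIdeal (h : IsQuadOrder O D δ) (Q : QF D N) : idealGroup O N :=
  ⟨(h.isUnit_rootIdeal Q.2.2.1.a_pos.ne' Q.2.2.2.1 Q.2.1).unit,
    h.mem_idealGroup Q.2.2.1.a_pos.ne' Q.2.2.2.1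
      (Int.isCoprime_iff_gcd_eq_one.mpr Q.2.2.2.2) rfl⟩

theorem coe_formIdeal (h : IsQuadOrder O D δ) (Q : QF D N) :
    ((h.formIdeal Q).1 : FractionalIdeal O⁰ K) = rootIdeal O δ Q.1 := rfl

/-- The scaling factor γτ' + d need not lie in O, so it is multiplied by a'. Then a'd + γ(a'τ') ≡
a'd mod N, and d is prime to N because αd ≡ 1 mod N. -/
theorem mk_formIdeal_eq_of_equiv (h : IsQuadOrder O D δ) {Q Q' : QF D N} (hQ : Q ≈ Q') :
    (QuotientGroup.mk (h.formIdeal Q) : RingClass₀ O N) = QuotientGroup.mk (h.formIdeal Q') := by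
  obtain ⟨α, β, γ, d, hdet, ⟨k, hk⟩, hQ'⟩ := BinForm.equivalent_gamma0_iff.mp hQ
  have ha := Q.2.2.1.a_pos.ne'
  have ha' := Q'.2.2.1.a_pos.ne'
  have hd' := Q'.2.2.2.1
  have hN' := Int.isCoprime_iff_gcd_eq_one.mpr Q'.2.2.2.2
  have haK' : (Q'.1.a : K) ≠ 0 := by exact_mod_cast ha'
  have key := h.spanSingleton_mul_rootIdeal_subst ha Q.2.2.2.1 (hQ' ▸ ha') hdet
  rw [← hQ'] at key
  have hne : (γ : K) * Q'.1.root δ + d ≠ 0 := by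
    intro h0
    obtain ⟨rfl, rfl⟩ := h.root_eq_zero ha' (m := d) (n := γ) (by linear_combination h0)
    simp at hdet
  rw [RingClass₀.mk_eq_mk_iff]
  refine ⟨Units.mk0 _ (mul_ne_zero haK' hne), Units.mk0 _ haK', ?_, isCongrInt_intCast hN', ?_⟩
  · refine ⟨Q'.1.a * d, hN'.mul_left ⟨α, -(β * k), ?_⟩, k * (Q'.1.a * Q'.1.root δ),
      O.mul_mem (intCast_mem O k) (h.a_mul_root_mem ha' hd'), ?_⟩
    · linear_combination hdet + β * hk
    · rw [Units.val_mk0, hk]; push_cast; ring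
  · rw [Units.val_mk0, Units.val_mk0, coe_formIdeal, coe_formIdeal,
      ← FractionalIdeal.spanSingleton_mul_spanSingleton, mul_assoc, key]

/-- The map `[Q] ↦ [ℤ + ℤ τ_Q]`. -/
noncomputable def toRingClass (h : IsQuadOrder O D δ) : FormClass D N → RingClass₀ O N :=
  Quotient.lift (fun Q => (QuotientGroup.mk (h.formIdeal Q) : RingClass₀ O N))
    fun _ _ hQ => h.mk_formIdeal_eq_of_equiv hQ

theorem toRingClass_mk (h : IsQuadOrder O D δ) (Q : QF D N) :
    h.toRingClass (FormClass.mk Q) = (QuotientGroup.mk (h.formIdeal Q) : RingClass₀ O N) := rfl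

theorem toRingClass_injective (h : IsQuadOrder O D δ) :
    Function.Injective (h.toRingClass : FormClass D N → RingClass₀ O N) := by
  intro X Y hXY
  induction X using Quotient.inductionOn with | _ Q
  induction Y using Quotient.inductionOn with | _ P
  refine Quotient.sound (Setoid.symm ?_)
  obtain ⟨x, y, ⟨c₀, hc₀, w, hw, hx⟩, ⟨b₀, hb₀, z, hz, hy⟩, hxy⟩ :=
    (RingClass₀.mk_eq_mk_iff _ _).mp hXY
  rw [coe_formIdeal, coe_formIdeal] at hxy
  have ha := Q.2.2.1.a_pos
  have ha' := P.2.2.1.a_pos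
  have hd := Q.2.2.2.1
  have hd' := P.2.2.2.1
  have hmem : ∀ t : K, t ∈ rootIdeal O δ Q.1 → ∃ m n : ℤ, x * t = y * (m + n * P.1.root δ) := by
    intro t ht
    have h1 : (x : K) * t ∈ FractionalIdeal.spanSingleton O⁰ (x : K) * rootIdeal O δ Q.1 :=
      FractionalIdeal.mem_singleton_mul.mpr ⟨t, ht, rfl⟩
    rw [hxy] at h1
    obtain ⟨s, hs, h2⟩ := FractionalIdeal.mem_singleton_mul.mp h1
    obtain ⟨m, n, rfl⟩ := (h.mem_rootIdeal ha'.ne' hd' s).mp hs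
    exact ⟨m, n, h2⟩
  have hmem' : ∀ t : K, t ∈ rootIdeal O δ P.1 → ∃ m n : ℤ, y * t = x * (m + n * Q.1.root δ) := by
    intro t ht
    have h1 : (y : K) * t ∈ FractionalIdeal.spanSingleton O⁰ (y : K) * rootIdeal O δ P.1 :=
      FractionalIdeal.mem_singleton_mul.mpr ⟨t, ht, rfl⟩
    rw [← hxy] at h1
    obtain ⟨s, hs, h2⟩ := FractionalIdeal.mem_singleton_mul.mp h1
    obtain ⟨m, n, rfl⟩ := (h.mem_rootIdeal ha.ne' hd s).mp hs
    exact ⟨m, n, h2⟩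
  obtain ⟨d, γ, e1⟩ := hmem 1 (one_mem_rootIdeal _)
  obtain ⟨β, α, e2⟩ := hmem _ (root_mem_rootIdeal _)
  obtain ⟨d₁, γ₁, e3⟩ := hmem' 1 (one_mem_rootIdeal _)
  obtain ⟨β₁, α₁, e4⟩ := hmem' _ (root_mem_rootIdeal _)
  have hx0 : (x : K) ≠ 0 := x.ne_zero
  have hy0 : (y : K) ≠ 0 := y.ne_zero
  -- The inclusions in the two directions give integral matrices inverse to each other.
  have hu : IsUnit (α * d - β * γ) := by
    obtain ⟨f1, f2⟩ := h.root_eq_of_eq ha.ne' (m := d * d₁ + γ * β₁) (n := d * γ₁ + γ * α₁)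
      (m' := 1) (n' := 0) (by
        apply mul_left_cancel₀ hx0
        push_cast
        linear_combination -e1 - d * e3 - γ * e4)
    obtain ⟨f3, f4⟩ := h.root_eq_of_eq ha.ne' (m := β * d₁ + α * β₁) (n := β * γ₁ + α * α₁)
      (m' := 0) (n' := 1) (by
        apply mul_left_cancel₀ hx0
        push_cast
        linear_combination -e2 - β * e3 - α * e4)
    refine IsUnit.of_mul_eq_one (α₁ * d₁ - β₁ * γ₁) ?_
    linear_combination (β * γ₁ + α * α₁) * f1 + f4 - (β * d₁ + α * β₁) * f2
  have hroot : Q.1.root δ * (γ * P.1.root δ + d) = α * P.1.root δ + β := by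
    apply mul_left_cancel₀ hy0
    linear_combination e2 - Q.1.root δ * e1
  obtain ⟨hdet, hsub⟩ := h.eq_subst_of_root ha' ha hd' hd hroot hu
  -- In x = y(d + γρ), with x and y congruent to c₀ and b₀ mod N, multiply by the leading
  -- coefficient to stay in O and compare coefficients of aρ: N divides b₀γ, and b₀ is prime to N.
  have hNγ : (N : ℤ) ∣ γ := by
    have hO : (P.1.a : K) * w - z * (P.1.a * d + γ * (P.1.a * P.1.root δ)) ∈ O :=
      O.sub_mem (O.mul_mem (intCast_mem O _) hw) (O.mul_mem hz (O.add_mem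
        (O.mul_mem (intCast_mem O _) (intCast_mem O _))
        (O.mul_mem (intCast_mem O _) (h.a_mul_root_mem ha'.ne' hd'))))
    obtain ⟨u, v, huv⟩ := (h.mem_iff_root ha'.ne' hd' _).mp hO
    obtain ⟨-, f⟩ := h.root_eq_of_eq ha'.ne' (m := b₀ * P.1.a * d - P.1.a * c₀)
      (n := P.1.a * (b₀ * γ)) (m' := N * u) (n' := P.1.a * (N * v)) (by
        rw [hx, hy] at e1
        push_cast
        linear_combination -P.1.a * e1 + N * huv)
    exact hb₀.symm.dvd_of_dvd_mul_left ⟨v, mul_left_cancel₀ ha'.ne' f⟩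
  exact BinForm.equivalent_gamma0_iff.mpr
    ⟨d, -β, -γ, α, by linear_combination hdet, hNγ.neg_right, hsub⟩

theorem toRingClass_dirichletComp (h : IsQuadOrder O D δ) {Q Q' Q'' : QF D N} {B : ℤ}
    (hc : Q.1.Composable Q'.1) (hB : Q.1.IsCompCoeff D Q'.1 B)
    (hQ : Q''.1 = Q.1.dirichletComp D Q'.1 B) :
    h.toRingClass (FormClass.mk Q'') =
      h.toRingClass (FormClass.mk Q) * h.toRingClass (FormClass.mk Q') := by
  rw [toRingClass_mk, toRingClass_mk, toRingClass_mk, ← QuotientGroup.mk_mul]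
  congr 1
  apply Subtype.ext
  apply Units.ext
  rw [Subgroup.coe_mul, Units.val_mul, coe_formIdeal, coe_formIdeal, coe_formIdeal, hQ]
  exact (h.rootIdeal_mul_rootIdeal Q.2.2.1.a_pos.ne' Q'.2.2.1.a_pos.ne' Q.2.2.2.1 Q'.2.2.2.1
    hc hB).symm

theorem exists_toRingClass_mul (h : IsQuadOrder O D δ) (hN : 0 < N) (X Y : FormClass D N) :
    ∃ Z : FormClass D N, h.toRingClass Z = h.toRingClass X * h.toRingClass Y := by
  obtain ⟨Q, Q', rfl, rfl, hcop⟩ := FormClass.exists_coprime_representatives hN X Y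
  have hc := BinForm.composable_of_gcd_eq_one hcop
  obtain ⟨B, hB⟩ := BinForm.exists_isCompCoeff Q.2.2.2.1 Q'.2.2.2.1 hc
  obtain ⟨Q'', hQ''⟩ := Q.exists_eq_dirichletComp Q' hB
  exact ⟨_, h.toRingClass_dirichletComp hc hB hQ''⟩

/-- The conjugate form inverts the class: the product of the lattices is a⁻¹O with a prime to N. -/
theorem exists_toRingClass_inv (h : IsQuadOrder O D δ) (X : FormClass D N) :
    ∃ Z : FormClass D N, h.toRingClass Z = (h.toRingClass X)⁻¹ := by
  induction X using Quotient.inductionOn with | _ Q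
  have ha := Q.2.2.1.a_pos
  have haK : (Q.1.a : K) ≠ 0 := by exact_mod_cast ha.ne'
  have hd := Q.2.2.2.1
  let P : QF D N := ⟨conjForm Q.1, by
      rw [BinForm.isPrimitive_iff]
      intro d h1 h2 h3
      exact BinForm.isPrimitive_iff.mp Q.2.1 d h1 ((dvd_neg).mp h2) h3,
    BinForm.isPosDef_of_a_pos ha (by rw [conjForm_disc]; exact Q.2.2.1.disc_neg),
    (conjForm_disc _).trans hd, Q.2.2.2.2⟩
  refine ⟨FormClass.mk P, eq_inv_of_mul_eq_one_right ?_⟩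
  change (QuotientGroup.mk (h.formIdeal Q * h.formIdeal P) : RingClass₀ O N) =
    QuotientGroup.mk 1
  rw [RingClass₀.mk_eq_mk_iff]
  refine ⟨Units.mk0 _ haK, 1, isCongrInt_intCast (Int.isCoprime_iff_gcd_eq_one.mpr Q.2.2.2.2),
    isCongrInt_one, ?_⟩
  rw [Subgroup.coe_mul, Units.val_mul, coe_formIdeal, coe_formIdeal, Units.val_mk0]
  change _ * (_ * rootIdeal O δ (conjForm Q.1)) = _
  rw [h.rootIdeal_mul_conj ha.ne' hd Q.2.1, FractionalIdeal.spanSingleton_mul_spanSingleton,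
    mul_inv_cancel₀ haK]
  simp

theorem exists_toRingClass_of_coprime (h : IsQuadOrder O D δ) (u : idealGroup O N) (J : Ideal O)
    (hu : (u.1 : FractionalIdeal O⁰ K) = (J : FractionalIdeal O⁰ K))
    (hJ : J ⊔ Ideal.span {(N : O)} = ⊤) :
    ∃ Z : FormClass D N, h.toRingClass Z = (QuotientGroup.mk u : RingClass₀ O N) := by
  have hJ0 : J ≠ ⊥ := by
    rintro rfl
    exact u.1.ne_zero (by rw [hu]; simp)
  obtain ⟨s, Q, hs, ha, hd, hJQ⟩ := h.exists_coeIdeal_eq J hJ0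
  have hsa : ((s * Q.a : ℤ) : K) ≠ 0 := by exact_mod_cast (mul_pos hs ha).ne'
  -- Write 1 = j + N·o and compare constant terms in the basis 1, aτ of O; that of j is a multiple
  -- of sa.
  have hcop : IsCoprime (s * Q.a) (N : ℤ) := by
    have h1 : (1 : O) ∈ J ⊔ Ideal.span {(N : O)} := by rw [hJ]; trivial
    obtain ⟨j, hj, n, hn, hjn⟩ := Submodule.mem_sup.mp h1
    obtain ⟨o, rfl⟩ := Ideal.mem_span_singleton.mp hn
    have hjI : (j : K) ∈ (J : FractionalIdeal O⁰ K) :=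
      (FractionalIdeal.mem_coeIdeal _).mpr ⟨j, hj, rfl⟩
    rw [hJQ] at hjI
    obtain ⟨y, hy, hjy⟩ := FractionalIdeal.mem_singleton_mul.mp hjI
    obtain ⟨m, n, rfl⟩ := (h.mem_rootIdeal ha.ne' hd y).mp hy
    obtain ⟨m', n', ho⟩ := (h.mem_iff_root ha.ne' hd _).mp o.2
    have hK : (j : K) + N * o = 1 := by
      simpa using congrArg (Subtype.val : O → K) hjn
    rw [hjy, ho] at hK
    obtain ⟨f, -⟩ := h.root_eq_of_eq ha.ne' (m := s * Q.a * m + N * m')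
      (n := s * Q.a * n + N * n' * Q.a) (m' := 1) (n' := 0) (by
        push_cast at hK ⊢
        linear_combination hK)
    exact ⟨m, m', by linear_combination f⟩
  have hprop : IsProperIdeal (rootIdeal O δ Q) := by
    rw [← isProperIdeal_spanSingleton_mul hsa, ← hJQ, ← hu]
    exact IsProperIdeal.of_isUnit (Units.isUnit _)
  let P : QF D N := ⟨Q, h.isPrimitive_of_isProperIdeal ha.ne' hd hprop,
    BinForm.isPosDef_of_a_pos ha (by rw [hd]; exact h.neg), hd,
    Int.isCoprime_iff_gcd_eq_one.mp hcop.of_mul_left_right⟩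
  refine ⟨FormClass.mk P, ?_⟩
  rw [toRingClass_mk, RingClass₀.mk_eq_mk_iff]
  refine ⟨Units.mk0 _ hsa, 1, isCongrInt_intCast hcop, isCongrInt_one, ?_⟩
  rw [hu, hJQ, coe_formIdeal, Units.val_mk0, Units.val_one, FractionalIdeal.spanSingleton_one,
    one_mul]

theorem toRingClass_surjective (h : IsQuadOrder O D δ) (hN : 0 < N) :
    Function.Surjective (h.toRingClass : FormClass D N → RingClass₀ O N) := by
  intro c
  induction c using QuotientGroup.induction_on with | _ u
  obtain ⟨u, hu⟩ := u
  induction hu using Subgroup.closure_induction with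
  | mem u hu =>
    have hu' := hu
    obtain ⟨J, hJ, -, hcop⟩ := hu'
    exact h.exists_toRingClass_of_coprime ⟨u, Subgroup.subset_closure hu⟩ J hJ hcop
  | one =>
    exact h.exists_toRingClass_of_coprime 1 ⊤ (by simp) (by simp)
  | mul u v hu hv ihu ihv =>
    obtain ⟨X, hX⟩ := ihu
    obtain ⟨Y, hY⟩ := ihv
    obtain ⟨Z, hZ⟩ := h.exists_toRingClass_mul hN X Y
    exact ⟨Z, by rw [hZ, hX, hY]; rfl⟩
  | inv u hu ih =>
    obtain ⟨X, hX⟩ := ih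
    obtain ⟨Z, hZ⟩ := h.exists_toRingClass_inv X
    exact ⟨Z, by rw [hZ, hX]; rfl⟩

/-- The bijection `[Q] ↦ [ℤ + ℤ τ_Q]` from form classes to ideal classes. -/
noncomputable def formClassEquiv (h : IsQuadOrder O D δ) (hN : 0 < N) :
    FormClass D N ≃ RingClass₀ O N :=
  Equiv.ofBijective h.toRingClass ⟨h.toRingClass_injective, h.toRingClass_surjective hN⟩

end IsQuadOrder

/-! ### Orders of quadratic fields as instances of `IsQuadOrder`. -/

namespace NumberField

variable {K : Type*} [Field K] [NumberField K]

/-- The ring of integers of a quadratic field has a `ℤ`-basis containing `1`. -/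
theorem exists_basis_one_of_finrank_eq_two (hK : Module.finrank ℚ K = 2) :
    ∃ b : Module.Basis (Fin 2) ℤ (RingOfIntegers K), b 0 = 1 := by
  have hrank : Module.finrank ℤ (RingOfIntegers K) = 2 := (RingOfIntegers.rank K).trans hK
  let e := Module.finBasisOfFinrankEq ℤ (RingOfIntegers K) hrank
  have hrep : ∀ x, x = e.repr x 0 • e 0 + e.repr x 1 • e 1 := fun x => by
    conv_lhs => rw [← e.sum_repr x, Fin.sum_univ_two]
  have hli : LinearIndependent ℤ ![e 0, e 1] := by
    convert e.linearIndependent using 1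
    ext i; fin_cases i <;> rfl
  have huniq := LinearIndependent.pair_iff.mp hli
  set p := e.repr 1 0
  set q := e.repr 1 1
  have h1 : (1 : RingOfIntegers K) = p • e 0 + q • e 1 := hrep 1
  -- A common divisor g of the coordinates of 1 is a unit of 𝓞_K, and its norm is g².
  have hcop : IsCoprime p q := by
    rw [← isRelPrime_iff_isCoprime]
    rintro g ⟨p', hp'⟩ ⟨q', hq'⟩
    have hg : (algebraMap ℤ (RingOfIntegers K) g) * (p' • e 0 + q' • e 1) = 1 := by
      rw [h1, hp', hq', ← Algebra.smul_def, smul_add, smul_smul, smul_smul]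
    have hn := congrArg (Algebra.norm ℤ) hg
    rw [map_mul, Algebra.norm_algebraMap_of_basis e, MonoidHom.map_one, Fintype.card_fin] at hn
    exact isUnit_of_dvd_one ((dvd_pow_self g two_ne_zero).trans (Dvd.intro _ hn))
  obtain ⟨u, v, huv⟩ := hcop
  have huv' : (u : RingOfIntegers K) * p + v * q = 1 := by exact_mod_cast huv
  -- The rows (p, q) and (−v, u) have determinant pu + qv = 1, so 1 and β form a basis.
  set β := -v • e 0 + u • e 1 with hβ
  have e0 : e 0 = u • (1 : RingOfIntegers K) + (-q) • β := by
    rw [h1, hβ]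
    simp only [zsmul_eq_mul]
    push_cast
    linear_combination -huv' * e 0
  have e1 : e 1 = v • (1 : RingOfIntegers K) + p • β := by
    rw [h1, hβ]
    simp only [zsmul_eq_mul]
    push_cast
    linear_combination -huv' * e 1
  have hli' : LinearIndependent ℤ ![(1 : RingOfIntegers K), β] := by
    rw [LinearIndependent.pair_iff]
    intro m n hmn
    obtain ⟨f1, f2⟩ := huniq (m * p - n * v) (m * q + n * u) (by
      rw [← hmn, h1, hβ]
      simp only [zsmul_eq_mul]; push_cast; ring)
    constructor
    · linear_combination -m * huv + u * f1 + v * f2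
    · linear_combination -n * huv - q * f1 + p * f2
  have hsp : ⊤ ≤ Submodule.span ℤ (Set.range ![(1 : RingOfIntegers K), β]) := by
    intro x _
    have m0 : (1 : RingOfIntegers K) ∈ Submodule.span ℤ (Set.range ![(1 : RingOfIntegers K), β]) :=
      Submodule.subset_span ⟨0, rfl⟩
    have m1 : β ∈ Submodule.span ℤ (Set.range ![(1 : RingOfIntegers K), β]) :=
      Submodule.subset_span ⟨1, rfl⟩
    rw [hrep x, e0, e1]
    refine Submodule.add_mem _ ?_ ?_ <;> refine Submodule.smul_mem _ _ ?_ <;>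
      exact Submodule.add_mem _ (Submodule.smul_mem _ _ m0) (Submodule.smul_mem _ _ m1)
  exact ⟨Module.Basis.mk hli' hsp, by simp⟩

/-- The ring of integers of a quadratic field is `ℤ[β]` with `β` a root of a quadratic polynomial
whose discriminant is the discriminant of the field. -/
theorem exists_quadratic_generator (hK : Module.finrank ℚ K = 2) :
    ∃ (β : RingOfIntegers K) (t n : ℤ), β ^ 2 = t * β - n ∧ discr K = t ^ 2 - 4 * n ∧
      ∀ x : RingOfIntegers K, ∃ p q : ℤ, x = p + q * β := by
  obtain ⟨b, hb⟩ := exists_basis_one_of_finrank_eq_two hK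
  have hrep : ∀ x, x = (b.repr x 0 : RingOfIntegers K) + (b.repr x 1) * b 1 := fun x => by
    conv_lhs => rw [← b.sum_repr x, Fin.sum_univ_two, hb]
    simp
  have hsq : b 1 ^ 2 = (b.repr (b 1 ^ 2) 1 : RingOfIntegers K) * b 1
      - ((-b.repr (b 1 ^ 2) 0 : ℤ) : RingOfIntegers K) := by
    conv_lhs => rw [hrep (b 1 ^ 2)]
    push_cast; ring
  refine ⟨b 1, b.repr (b 1 ^ 2) 1, -b.repr (b 1 ^ 2) 0, hsq, ?_, fun x => ⟨_, _, hrep x⟩⟩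
  set t := b.repr (b 1 ^ 2) 1 with ht
  set n := -b.repr (b 1 ^ 2) 0
  -- The trace matrix of the basis 1, β has rows (2, t) and (t, t² − 2n), with determinant t² − 4n.
  have tr1 : Algebra.trace ℤ (RingOfIntegers K) 1 = 2 := by
    have := Algebra.trace_algebraMap_of_basis b (1 : ℤ)
    simpa using this
  have trβ : Algebra.trace ℤ (RingOfIntegers K) (b 1) = t := by
    rw [Algebra.trace_eq_matrix_trace b, Matrix.trace_fin_two, Algebra.leftMulMatrix_eq_repr_mul,
      Algebra.leftMulMatrix_eq_repr_mul, hb, mul_one, ← sq]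
    simp [ht]
  have trsq : Algebra.trace ℤ (RingOfIntegers K) (b 1 * b 1) = t * t - 2 * n := by
    have : b 1 * b 1 = t • b 1 - n • (1 : RingOfIntegers K) := by
      rw [← sq, hsq]; simp
    rw [this, map_sub, map_smul, map_smul, trβ, tr1]
    simp [mul_comm]
  rw [← discr_eq_discr K b, Algebra.discr_def, Matrix.det_fin_two]
  simp only [Algebra.traceMatrix_apply, Algebra.traceForm_apply, hb, mul_one, one_mul, tr1, trβ,
    trsq]
  ring

end NumberField

namespace IsQuadOrder

/-- This allows δ to be chosen as the square root of D in the upper half plane, so that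
`BinForm.root` becomes `tau`. -/
theorem neg_root {K : Type*} [Field K] [CharZero K] {O : Subring K} {D : ℤ} {δ : K}
    (h : IsQuadOrder O D δ) : IsQuadOrder O D (-δ) where
  neg := h.neg
  mod_four := h.mod_four
  sq := by rw [neg_sq, h.sq]
  mem_iff x := by
    rw [h.mem_iff]
    constructor
    · rintro ⟨m, n, rfl⟩
      exact ⟨m + n * D, -n, by push_cast; ring⟩
    · rintro ⟨m, n, rfl⟩
      exact ⟨m + n * D, -n, by push_cast; ring⟩
  exists_rep x := by
    obtain ⟨k, m, n, hk, hx⟩ := h.exists_rep x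
    exact ⟨k, m, -n, hk, by rw [hx]; push_cast; ring⟩

theorem exists_sq_sub_eq_four_mul {D : ℤ} (hD4 : D % 4 = 0 ∨ D % 4 = 1) :
    ∃ e : ℤ, D ^ 2 - D = 4 * e := by
  rcases hD4 with h | h
  · exact ⟨D / 4 * (D - 1), by
      have : D = 4 * (D / 4) := by omega
      linear_combination (D - 1) * this⟩
  · exact ⟨D * (D / 4), by
      have : D = 4 * (D / 4) + 1 := by omega
      linear_combination D * this⟩

theorem exists_subring {K : Type*} [Field K] [CharZero K] {D : ℤ} {δ : K} (hD : D < 0)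
    (hD4 : D % 4 = 0 ∨ D % 4 = 1) (hsq : δ ^ 2 = D)
    (hrep : ∀ x : K, ∃ k m n : ℤ, k ≠ 0 ∧ k * x = m + n * δ) :
    ∃ O : Subring K, IsQuadOrder O D δ := by
  obtain ⟨e, he⟩ := exists_sq_sub_eq_four_mul hD4
  have heK : (D : K) ^ 2 - D = 4 * e := by exact_mod_cast he
  let O : Subring K :=
    { carrier := {x | ∃ m n : ℤ, x = m + n * ((D + δ) / 2)}
      zero_mem' := ⟨0, 0, by simp⟩
      one_mem' := ⟨1, 0, by simp⟩
      add_mem' := by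
        rintro _ _ ⟨m, n, rfl⟩ ⟨m', n', rfl⟩
        exact ⟨m + m', n + n', by push_cast; ring⟩
      neg_mem' := by
        rintro _ ⟨m, n, rfl⟩
        exact ⟨-m, -n, by push_cast; ring⟩
      mul_mem' := by
        rintro _ _ ⟨m, n, rfl⟩ ⟨m', n', rfl⟩
        refine ⟨m * m' - n * n' * e, m * n' + m' * n + n * n' * D, ?_⟩
        push_cast
        linear_combination (n : K) * n' / 4 * (hsq - heK) }
  exact ⟨O, hD, ⟨e, he⟩, hsq, fun x => Iff.rfl, hrep⟩

/-- For every negative `D ≡ 0, 1 (mod 4)` there is a quadratic order of discriminant `D`. -/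
theorem exists_order {D : ℤ} (hD : D < 0) (hD4 : D % 4 = 0 ∨ D % 4 = 1) :
    ∃ (K : Type) (_ : Field K) (_ : CharZero K) (O : Subring K) (δ : K), IsQuadOrder O D δ := by
  -- A negative D is not a rational square; this makes the quadratic algebra a field.
  have hfact : Fact (∀ r : ℚ, r ^ 2 ≠ (D : ℚ) + 0 * r) := ⟨fun r hr => by
    have : (D : ℚ) < 0 := by exact_mod_cast hD
    nlinarith [sq_nonneg r]⟩
  have hchar : CharZero (QuadraticAlgebra ℚ (D : ℚ) 0) := algebraRat.charZero _
  have hsq : (⟨0, 1⟩ : QuadraticAlgebra ℚ (D : ℚ) 0) ^ 2 = (D : QuadraticAlgebra ℚ (D : ℚ) 0) := by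
    rw [pow_two]
    apply QuadraticAlgebra.ext <;> simp
  obtain ⟨O, hO⟩ := exists_subring hD hD4 hsq fun x => by
    refine ⟨x.re.den * x.im.den, x.re.num * x.im.den, x.im.num * x.re.den, by positivity, ?_⟩
    have h1 := Rat.den_mul_eq_num x.re
    have h2 := Rat.den_mul_eq_num x.im
    push_cast
    apply QuadraticAlgebra.ext
    · simp
      linear_combination (x.im.den : ℚ) * h1
    · simp
      linear_combination (x.re.den : ℚ) * h2
  exact ⟨_, inferInstance, hchar, O, _, hO⟩

/-- The order of conductor `f` in a quadratic field has discriminant `f² d_K`. -/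
theorem of_quadOrder {K : Type*} [Field K] [NumberField K] {D : ℤ} (hD : D < 0) {f : ℕ}
    (hK : Module.finrank ℚ K = 2) (hf : (f : ℤ) ^ 2 * NumberField.discr K = D) :
    ∃ δ : K, IsQuadOrder (quadOrder K f) D δ := by
  obtain ⟨β, t, n, hβ, hdisc, hgen⟩ := NumberField.exists_quadratic_generator hK
  have hβK : (β : K) ^ 2 = t * β - n := by
    have := congrArg (algebraMap (NumberField.RingOfIntegers K) K) hβ
    simpa using this
  have hgenK : ∀ x : NumberField.RingOfIntegers K, ∃ p q : ℤ, (x : K) = p + q * β := by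
    intro x
    obtain ⟨p, q, hx⟩ := hgen x
    refine ⟨p, q, ?_⟩
    rw [hx]; simp
  have hD' : D = (f * t) ^ 2 - 4 * (f ^ 2 * n) := by rw [← hf, hdisc]; ring
  have hDK : (D : K) = (f * t) ^ 2 - 4 * (f ^ 2 * n) := by rw [hD']; push_cast; ring
  have hf0 : f ≠ 0 := by rintro rfl; simp at hf; omega
  obtain ⟨r, hr⟩ : Even (D - f * t) := by
    have : D - f * t = f * t * (f * t - 1) + 2 * (-2 * (f ^ 2 * n)) := by rw [hD']; ring
    rw [this]
    exact (Int.even_mul_pred_self _).add (even_two_mul _)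
  have hrK : (D : K) - f * t = r + r := by exact_mod_cast hr
  -- Then δ² = f²(t² − 4n) = D, and fβ = (ft + δ)/2 differs from (D + δ)/2 by the integer r.
  refine ⟨f * (2 * β - t), hD, ?_, ?_, fun x => ?_, fun x => ?_⟩
  · refine exists_sq_sub_eq_four_mul ?_
    obtain ⟨k, hk | hk⟩ := Int.even_or_odd' (f * t)
    · have : D = 4 * (k ^ 2 - f ^ 2 * n) := by rw [hD', hk]; ring
      omega
    · have : D = 4 * (k ^ 2 + k - f ^ 2 * n) + 1 := by rw [hD', hk]; ring
      omega
  · rw [hDK]; linear_combination 4 * (f : K) ^ 2 * hβK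
  · constructor
    · rintro ⟨m, y, rfl⟩
      obtain ⟨p, q, hy⟩ := hgenK y
      refine ⟨m + f * p - q * r, q, ?_⟩
      rw [hy]; push_cast
      linear_combination -(q : K) / 2 * hrK
    · rintro ⟨m, k, rfl⟩
      have hk : ((k * β : NumberField.RingOfIntegers K) : K) = k * β := by simp
      refine ⟨m + k * r, k * β, ?_⟩
      rw [hk]
      push_cast
      linear_combination (k : K) / 2 * hrK
  · obtain ⟨k, hk, h_smul⟩ := ((IsFractionRing.isAlgebraic_iff ℤ ℚ K).mpr
      (Algebra.IsAlgebraic.isAlgebraic (R := ℚ) x)).exists_integral_multiple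
    obtain ⟨p, q, hpq⟩ := hgenK ⟨k • x, h_smul⟩
    have hpq' : (k : K) * x = p + q * β := by rw [← hpq]; simp
    refine ⟨2 * f * k, 2 * f * p + f * q * t, q, ?_, ?_⟩
    · have : (f : ℤ) ≠ 0 := by exact_mod_cast hf0
      positivity
    · push_cast
      linear_combination 2 * (f : K) * hpq'

end IsQuadOrder

/-! ### Transport of the group structure and the isomorphism for every K. -/

theorem mainTheorem1 (D : ℤ) (hD : D < 0) (hD4 : D % 4 = 0 ∨ D % 4 = 1) (N : ℕ) (hN : 0 < N) :
    ∃ _ : CommGroup (FormClass D N),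
      -- any two classes have representatives with coprime leading coefficients
      (∀ X Y : FormClass D N, ∃ Q Q' : QF D N,
        FormClass.mk Q = X ∧ FormClass.mk Q' = Y ∧ Int.gcd Q.1.a Q'.1.a = 1) ∧
      -- the middle coefficient of the Dirichlet composition exists, uniquely modulo `2aa'`
      (∀ Q Q' : QF D N, Q.1.Composable Q'.1 →
        ∃ B : ℤ, Q.1.IsCompCoeff D Q'.1 B ∧
          ∀ B' : ℤ, Q.1.IsCompCoeff D Q'.1 B' → B' ≡ B [ZMOD 2 * (Q.1.a * Q'.1.a)]) ∧
      -- the group law is Dirichlet composition, for every choice of composable representatives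
      -- and of the middle coefficient
      (∀ (Q Q' : QF D N) (B : ℤ), Q.1.Composable Q'.1 → Q.1.IsCompCoeff D Q'.1 B →
        ∃ Q'' : QF D N, Q''.1 = Q.1.dirichletComp D Q'.1 B ∧
          FormClass.mk Q * FormClass.mk Q' = FormClass.mk Q'') ∧
      -- for the order `O = ℤ + f 𝓞_K` of discriminant `D` in an imaginary quadratic field
      ∀ (K : IntermediateField ℚ ℂ) [NumberField K] (f : ℕ),
        Module.finrank ℚ K = 2 → (f : ℤ) ^ 2 * NumberField.discr K = D →
        -- the proper fractional ideals are the elements of the group of invertible ones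
        (∀ I : FractionalIdeal (quadOrder K f)⁰ K, IsProperIdeal I ↔ IsUnit I) ∧
        -- `[Q] ↦ [ℤ + ℤ τ_Q]` is an isomorphism of groups
        ∃ Φ : FormClass D N ≃* RingClass₀ (quadOrder K f) N,
          ∀ Q : QF D N, ∃ u : idealGroup (quadOrder K f) N,
            {z : ℂ | ∃ x ∈ ((u : (FractionalIdeal (quadOrder K f)⁰ K)ˣ) :
              FractionalIdeal (quadOrder K f)⁰ K), (x : ℂ) = z} =
              {z : ℂ | ∃ m n : ℤ, z = m + n * Q.1.tau} ∧
            Φ (FormClass.mk Q) = (QuotientGroup.mk u : RingClass₀ (quadOrder K f) N) := by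
  obtain ⟨F, _, _, O, δ₀, h₀⟩ := IsQuadOrder.exists_order hD hD4
  have := h₀.isFractionRing
  let group : CommGroup (FormClass D N) := (h₀.formClassEquiv hN).commGroup
  have hmul : ∀ (Q Q' : QF D N) (B : ℤ), Q.1.Composable Q'.1 → Q.1.IsCompCoeff D Q'.1 B →
      ∃ Q'' : QF D N, Q''.1 = Q.1.dirichletComp D Q'.1 B ∧
        FormClass.mk Q * FormClass.mk Q' = FormClass.mk Q'' := by
    intro Q Q' B hc hB
    obtain ⟨Q'', hQ''⟩ := Q.exists_eq_dirichletComp Q' hB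
    refine ⟨Q'', hQ'', ?_⟩
    apply (h₀.formClassEquiv hN).injective
    exact (map_mul (h₀.formClassEquiv hN).mulEquiv _ _).trans
      (h₀.toRingClass_dirichletComp hc hB hQ'').symm
  refine ⟨group, FormClass.exists_coprime_representatives hN, ?_, hmul, ?_⟩
  · intro Q Q' hc
    obtain ⟨B, hB⟩ := BinForm.exists_isCompCoeff Q.2.2.2.1 Q'.2.2.2.1 hc
    exact ⟨B, hB, fun B' hB' => BinForm.IsCompCoeff.modEq Q.2.2.2.1 Q'.2.2.2.1 hc hB hB'⟩
  · intro K _ f hK hf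
    obtain ⟨δ, h, hδ⟩ : ∃ δ : K, IsQuadOrder (quadOrder K f) D δ ∧
        (δ : ℂ) = (Real.sqrt (-(D : ℝ)) : ℂ) * Complex.I := by
      obtain ⟨δ, h⟩ := IsQuadOrder.of_quadOrder hD hK hf
      have hs : ((Real.sqrt (-(D : ℝ)) : ℂ) * Complex.I) ^ 2 = D := by
        have h1 : Real.sqrt (-(D : ℝ)) ^ 2 = -(D : ℝ) :=
          Real.sq_sqrt (by have : (D : ℝ) < 0 := by exact_mod_cast hD
                           linarith)
        rw [mul_pow, Complex.I_sq, ← Complex.ofReal_pow, h1]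
        simp
      have hsq : (δ : ℂ) ^ 2 = ((Real.sqrt (-(D : ℝ)) : ℂ) * Complex.I) ^ 2 := by
        rw [hs]
        exact_mod_cast congrArg (Subtype.val : K → ℂ) h.sq
      rcases sq_eq_sq_iff_eq_or_eq_neg.mp hsq with h1 | h1
      · exact ⟨δ, h, h1⟩
      · exact ⟨-δ, h.neg_root, by push_cast; rw [h1, neg_neg]⟩
    have := h.isFractionRing
    refine ⟨h.isProperIdeal_iff_isUnit, ⟨h.formClassEquiv hN, fun X Y => ?_⟩, fun Q => ?_⟩
    -- The product was transported from the auxiliary order, so it is compared with the product over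
    -- K through the Dirichlet composition of coprime representatives.
    · obtain ⟨Q, Q', rfl, rfl, hcop⟩ := FormClass.exists_coprime_representatives hN X Y
      have hc := BinForm.composable_of_gcd_eq_one hcop
      obtain ⟨B, hB⟩ := BinForm.exists_isCompCoeff Q.2.2.2.1 Q'.2.2.2.1 hc
      obtain ⟨Q'', hQ'', hprod⟩ := hmul Q Q' B hc hB
      rw [hprod]
      exact h.toRingClass_dirichletComp hc hB hQ''
    · refine ⟨h.formIdeal Q, ?_, rfl⟩
      have hroot : ((Q.1.root δ : K) : ℂ) = Q.1.tau := by
        rw [BinForm.tau, Q.2.2.2.1, ← hδ, BinForm.root]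
        push_cast
        rfl
      ext z
      simp only [Set.mem_ofPred_eq, IsQuadOrder.coe_formIdeal,
        h.mem_rootIdeal Q.2.2.1.a_pos.ne' Q.2.2.2.1]
      constructor
      · rintro ⟨x, ⟨m, n, rfl⟩, rfl⟩
        exact ⟨m, n, by rw [← hroot]; push_cast; rfl⟩
      · rintro ⟨m, n, rfl⟩
        exact ⟨m + n * Q.1.root δ, ⟨m, n, rfl⟩, by rw [← hroot]; push_cast; rfl⟩
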